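/- Let $R$ be a commutative unital ring. Consider fractions $X/G$, where $G$ is a finite group and $X$ a finite $G$-set. For fractions $X/G$ and $Y/H$, let $RB^{H,G}(Y,X)=R\otimes_{\mathbb Z}B^{H,G}(Y,X)$, where $B^{H,G}(Y,X)$ is the Grothendieck group, for disjoint unions, of triples $(U,\beta,\alpha)$ with $U$ a finite $(H\times G)$-set and $\beta:U\to Y$, $\alpha:U\to X$ maps satisfying $\beta((h,g)u)=h\beta(u)$ and $\alpha((h,g)u)=g\alpha(u)$; the class of $(U,\beta,\alpha)$ is written $\langle U,\beta,\alpha\rangle$. We regard $U$ as an $(H,G)$-biset by $(h,g)u=hug^{-1}$. For triples $(U,\beta,\alpha)$ from $X/G$ to $Y/H$ and $(V,\delta,\gamma)$ from $Y/H$ to $Z/K$, let $V\hat\times_H U$ be the set of $H$-orbits $[v,u]$ on $\{(v,u)\in V\times U:\gamma(v)=\beta(u)\}$ for $(v,u)\cdot h=(vh,h^{-1}u)$, with the action $(k,g)[v,u]=[kv,ug^{-1}]$ and the maps $\hat\delta[v,u]=\delta(v)$, $\hat\alpha[v,u]=\alpha(u)$. **Theorem.** 1. Isomorphic triples have isomorphic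 composites, and $\langle V,\delta,\gamma\rangle\circ\langle U,\beta,\alpha\rangle=\langle V\hat\times_HU,\hat\delta,\hat\alpha\rangle$ extends to a unique family of $R$-bilinear maps $RB^{K,H}(Z,Y)\times RB^{H,G}(Y,X)\to RB^{K,G}(Z,X)$. This composition is associative, and the class of $G\times X$ with the action $(a,b)(g,x)=(agb^{-1},ax)$ and the maps $\underline 1(g,x)=x$, $\overline 1(g,x)=g^{-1}x$ is the identity of $X/G$. So the fractions form a category $\mathscr C_R$ with $\mathrm{Hom}(X/G,Y/H)=RB^{H,G}(Y,X)$. 2. $\mathscr C_R$ is additive: it is preadditive with finite biproducts, $\emptyset/1$ is a zero object, and a biproduct of $X/G$ and $Y/H$ is $$\frac XG\oplus\frac YH=\frac{(X\times H)\sqcup(G\times Y)}{G\times H},$$ where $(g,h)$ acts by $(x,h')\mapsto(gx,hh')$ and $(g',y)\mapsto(gg',hy)$. 3. $\mathscr C_R$ is symmetric monoidal, with $\frac XG\otimes\frac YH=\frac{X\times Y}{G\times H}$ (where $(g,h)(x,y)=(gx,hy)$) and unit $\{\bullet\}/1$. The tensor product of morphisms is $R$-bilinear and satisfies $\langle U,\beta,\alpha\rangle\otimes\langle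 U',\beta',\alpha'\rangle=\langle U\times U',\beta\times\beta',\alpha\times\alpha'\rangle$. The associator, unitors and symmetry are the isomorphisms induced by the canonical isomorphisms of groups and bijections of sets; here a group isomorphism $f:G\to H$ and a bijection $t:X\to Y$ with $t(gx)=f(g)t(x)$ induce the class in $RB^{H,G}(Y,X)$ of $H\times Y$ with the action $(h_1,g)(h,y)=(h_1hf(g)^{-1},h_1y)$ and the maps $(h,y)\mapsto y$ and $(h,y)\mapsto t^{-1}(h^{-1}y)$. 4. $\mathscr C_R$ is self-dual: there are $R$-linear maps $RB^{H,G}(Y,X)\to RB^{G,H}(X,Y)$ with $\langle U,\beta,\alpha\rangle\mapsto\langle U^{\mathrm{op}},\alpha,\beta\rangle$, where $U^{\mathrm{op}}$ is $U$ with $(g,h)$ acting as $(h,g)$, and together with the identity on objects they form an equivalence of categories $\mathscr C_R\to\mathscr C_R^{\mathrm{op}}$. -/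

import Mathlib

open CategoryTheory CategoryTheory.Limits
open scoped TensorProduct

universe u v

/-! ### Objects: fractions `X/G` -/

/-- An object of the category `C_R`: a finite group `G` together with a finite (left) `G`-set `X`,
thought of as a fraction `X/G`. The ring `R` of coefficients only serves to fix the category to
which the object belongs. -/
structure GFrac (R : Type v) [CommRing R] : Type (u + 1) where
  /-- the finite group `G` -/
  Grp : Type u
  /-- the finite `G`-set `X` -/
  Pts : Type u
  [group : Group Grp]
  [finiteGrp : Finite Grp]
  [action : MulAction Grp Pts]
  [finitePts : Finite Pts]

namespace GFrac

attribute [instance] GFrac.group GFrac.finiteGrp GFrac.action GFrac.finitePts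

variable {R : Type v} [CommRing R]

/-- The object `∅/1`. -/
def zeroObj : GFrac.{u} R where
  Grp := PUnit
  Pts := PEmpty
  action :=
    { smul := fun _ x => x
      one_smul := fun _ => rfl
      mul_smul := fun _ _ _ => rfl }

/-- The object `{•}/1`. -/
def unitObj : GFrac.{u} R where
  Grp := PUnit
  Pts := PUnit
  action :=
    { smul := fun _ x => x
      one_smul := fun _ => rfl
      mul_smul := fun _ _ _ => rfl }

/-- `X/G ⊕ Y/H = ((X × H) ⊔ (G × Y)) / (G × H)`, where `(g, h)` acts by
`(x, h') ↦ (g x, h h')` on `X × H` and by `(g', y) ↦ (g g', h y)` on `G × Y`. -/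
def sumObj (A B : GFrac.{u} R) : GFrac.{u} R where
  Grp := A.Grp × B.Grp
  Pts := (A.Pts × B.Grp) ⊕ (A.Grp × B.Pts)
  action :=
    { smul := fun k => Sum.map (fun p => (k.1 • p.1, k.2 * p.2)) (fun p => (k.1 * p.1, k.2 • p.2))
      one_smul := by
        rintro (⟨x, h⟩ | ⟨g, y⟩)
        · exact congrArg Sum.inl (Prod.ext (one_smul _ x) (one_mul h))
        · exact congrArg Sum.inr (Prod.ext (one_mul g) (one_smul _ y))
      mul_smul := by
        rintro ⟨g₁, h₁⟩ ⟨g₂, h₂⟩ (⟨x, h⟩ | ⟨g, y⟩)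
        · exact congrArg Sum.inl (Prod.ext (mul_smul g₁ g₂ x) (mul_assoc h₁ h₂ h))
        · exact congrArg Sum.inr (Prod.ext (mul_assoc g₁ g₂ g) (mul_smul h₁ h₂ y)) }

/-- `X/G ⊗ Y/H = (X × Y) / (G × H)`, where `(g, h)` acts by `(x, y) ↦ (g x, h y)`. -/
def tensObj (A B : GFrac.{u} R) : GFrac.{u} R where
  Grp := A.Grp × B.Grp
  Pts := A.Pts × B.Pts
  action :=
    { smul := fun k p => (k.1 • p.1, k.2 • p.2)
      one_smul := fun p => Prod.ext (one_smul _ p.1) (one_smul _ p.2)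
      mul_smul := fun k l p => Prod.ext (mul_smul k.1 l.1 p.1) (mul_smul k.2 l.2 p.2) }

/-! ### Generating morphisms: spans of bisets -/

/-- A generating triple `(U, β, α)` from `A = X/G` to `B = Y/H`: a finite `(H × G)`-set `U` with
morphisms of `(H × G)`-sets `β : U → Y` and `α : U → X`, where `H × G` acts on `Y` through its
projection to `H` and on `X` through its projection to `G`.
The `(H × G)`-set `U` is seen as an `(H, G)`-biset through `(h, g) • u = h u g⁻¹`. -/
structure Span (A B : GFrac.{u} R) : Type (u + 1) where
  /-- the `(H × G)`-set `U` -/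
  U : Type u
  [action : MulAction (B.Grp × A.Grp) U]
  [finite : Finite U]
  /-- the map `β : U → Y` -/
  β : U → B.Pts
  /-- the map `α : U → X` -/
  α : U → A.Pts
  β_smul : ∀ (k : B.Grp × A.Grp) (u : U), β (k • u) = k.1 • β u
  α_smul : ∀ (k : B.Grp × A.Grp) (u : U), α (k • u) = k.2 • α u

namespace Span

attribute [instance] Span.action Span.finite

variable {A B C A' B' : GFrac.{u} R}

/-- Two triples `(U, β, α)` and `(U', β', α')` are isomorphic if there is an isomorphism of
`(H × G)`-sets `U → U'` that commutes with the maps to `Y` and `X`. -/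
def IsIso (S T : Span A B) : Prop :=
  ∃ e : S.U ≃ T.U, (∀ (k : B.Grp × A.Grp) (u : S.U), e (k • u) = k • e u) ∧
    (∀ u, T.β (e u) = S.β u) ∧ (∀ u, T.α (e u) = S.α u)

/-- The disjoint union of two triples. -/
def disjUnion (S T : Span A B) : Span A B where
  U := S.U ⊕ T.U
  β := Sum.elim S.β T.β
  α := Sum.elim S.α T.α
  β_smul := by
    rintro k (u | u)
    · exact S.β_smul k u
    · exact T.β_smul k u
  α_smul := by
    rintro k (u | u)
    · exact S.α_smul k u
    · exact T.α_smul k u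

/-- The identity triple `(G × X, (g, x) ↦ x, (g, x) ↦ g⁻¹ x)` of `X/G`, with the action
`(a, b) (g, x) = (a g b⁻¹, a x)`. -/
def id (A : GFrac.{u} R) : Span A A where
  U := A.Grp × A.Pts
  action :=
    { smul := fun k p => (k.1 * p.1 * k.2⁻¹, k.1 • p.2)
      one_smul := fun p => Prod.ext
        (show 1 * p.1 * 1⁻¹ = p.1 by simp) (one_smul _ p.2)
      mul_smul := fun k l p => Prod.ext
        (show k.1 * l.1 * p.1 * (k.2 * l.2)⁻¹ = k.1 * (l.1 * p.1 * l.2⁻¹) * k.2⁻¹ by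
          simp [mul_assoc]) (mul_smul k.1 l.1 p.2) }
  β := fun p => p.2
  α := fun p => p.1⁻¹ • p.2
  β_smul := fun _ _ => rfl
  α_smul := fun k p =>
    show (k.1 * p.1 * k.2⁻¹)⁻¹ • (k.1 • p.2) = k.2 • (p.1⁻¹ • p.2) by
      simp [mul_smul]

/-- The pullback `W = {(v, u) ∈ V × U | γ v = β u}`. -/
def Pullback (V : Span B C) (U : Span A B) : Type u :=
  {p : V.U × U.U // V.α p.1 = U.β p.2}

/-- Two elements of the pullback `W` are equivalent if they lie in the same orbit of the right
action `(v, u) · h = (v h, h⁻¹ u)` of `H`. In terms of the left actions of `K × H` on `V` and of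
`H × G` on `U` we have `v h = (1, h⁻¹) • v` and `h⁻¹ u = (h⁻¹, 1) • u`. -/
def pullbackSetoid (V : Span B C) (U : Span A B) : Setoid (Pullback V U) where
  r p q := ∃ h : B.Grp,
    q.1.1 = ((1 : C.Grp), h⁻¹) • p.1.1 ∧ q.1.2 = (h⁻¹, (1 : A.Grp)) • p.1.2
  iseqv :=
    { refl := fun p => ⟨1, by
        rw [inv_one]; exact ⟨(one_smul _ _).symm, (one_smul _ _).symm⟩⟩
      symm := by
        rintro p q ⟨h, h₁, h₂⟩
        refine ⟨h⁻¹, ?_, ?_⟩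
        · rw [h₁, smul_smul]; simp [← Prod.one_eq_mk]
        · rw [h₂, smul_smul]; simp [← Prod.one_eq_mk]
      trans := by
        rintro p q r ⟨h, h₁, h₂⟩ ⟨l, l₁, l₂⟩
        refine ⟨h * l, ?_, ?_⟩
        · rw [l₁, h₁, smul_smul]; simp
        · rw [l₂, h₂, smul_smul]; simp }

/-- The action of `K × G` on the `H`-orbits of the pullback: `(k, g) • [v, u] = [k v, u g⁻¹]`. -/
instance pullbackAction (V : Span B C) (U : Span A B) :
    MulAction (C.Grp × A.Grp) (Quotient (pullbackSetoid V U)) where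
  smul k := Quotient.map
    (fun p : Pullback V U => (⟨((k.1, (1 : B.Grp)) • p.1.1, ((1 : B.Grp), k.2) • p.1.2), by
      rw [V.α_smul, U.β_smul, p.2]⟩ : Pullback V U))
    (by
      rintro p q ⟨h, h₁, h₂⟩
      refine ⟨h, ?_, ?_⟩
      · change (k.1, (1 : B.Grp)) • q.1.1 = ((1 : C.Grp), h⁻¹) • (k.1, (1 : B.Grp)) • p.1.1
        rw [h₁, smul_smul, smul_smul]; simp
      · change ((1 : B.Grp), k.2) • q.1.2 = (h⁻¹, (1 : A.Grp)) • ((1 : B.Grp), k.2) • p.1.2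
        rw [h₂, smul_smul, smul_smul]; simp)
  one_smul := by
    rintro ⟨p⟩
    exact congrArg (Quotient.mk _) (Subtype.ext (Prod.ext (one_smul _ _) (one_smul _ _)))
  mul_smul := by
    rintro k l ⟨p⟩
    refine congrArg (Quotient.mk _) (Subtype.ext (Prod.ext ?_ ?_))
    · change (k.1 * l.1, (1 : B.Grp)) • p.1.1 = (k.1, (1 : B.Grp)) • (l.1, (1 : B.Grp)) • p.1.1
      rw [smul_smul]; simp
    · change ((1 : B.Grp), k.2 * l.2) • p.1.2
        = ((1 : B.Grp), k.2) • ((1 : B.Grp), l.2) • p.1.2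
      rw [smul_smul]; simp

/-- The composite `(V ×̂_H U, [v, u] ↦ δ v, [v, u] ↦ α u)` of `(U, β, α)` from `X/G` to `Y/H` and
`(V, δ, γ)` from `Y/H` to `Z/K`. -/
def comp (V : Span B C) (U : Span A B) : Span A C where
  U := Quotient (pullbackSetoid V U)
  finite :=
    haveI : Finite (Pullback V U) := inferInstanceAs (Finite {p : V.U × U.U // _})
    inferInstance
  β := Quotient.lift (fun p : Pullback V U => V.β p.1.1) (by
    rintro p q ⟨h, h₁, -⟩
    rw [h₁, V.β_smul, one_smul])
  α := Quotient.lift (fun p : Pullback V U => U.α p.1.2) (by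
    rintro p q ⟨h, -, h₂⟩
    rw [h₂, U.α_smul, one_smul])
  β_smul := by
    rintro k ⟨p⟩
    exact V.β_smul (k.1, 1) p.1.1
  α_smul := by
    rintro k ⟨p⟩
    exact U.α_smul (1, k.2) p.1.2

/-- The opposite triple `(U^op, α, β)` from `Y/H` to `X/G`: the set `U` with `(g, h)` acting as
`(h, g)`. -/
def op (S : Span A B) : Span B A where
  U := S.U
  action := MulAction.compHom S.U (MulEquiv.prodComm : A.Grp × B.Grp ≃* B.Grp × A.Grp).toMonoidHom
  β := S.α
  α := S.β
  β_smul := fun k u => S.α_smul k.swap u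
  α_smul := fun k u => S.β_smul k.swap u

/-- The product `(U × U', β × β', α × α')` of two triples. -/
def tens (S : Span A B) (S' : Span A' B') : Span (tensObj A A') (tensObj B B') where
  U := S.U × S'.U
  action :=
    { smul := fun k p => ((k.1.1, k.2.1) • p.1, (k.1.2, k.2.2) • p.2)
      one_smul := fun p => Prod.ext (one_smul _ p.1) (one_smul _ p.2)
      mul_smul := fun k l p => Prod.ext
        (mul_smul (k.1.1, k.2.1) (l.1.1, l.2.1) p.1) (mul_smul (k.1.2, k.2.2) (l.1.2, l.2.2) p.2) }
  β := fun p => (S.β p.1, S'.β p.2)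
  α := fun p => (S.α p.1, S'.α p.2)
  β_smul := fun k p => Prod.ext
    (S.β_smul (k.1.1, k.2.1) p.1) (S'.β_smul (k.1.2, k.2.2) p.2)
  α_smul := fun k p => Prod.ext
    (S.α_smul (k.1.1, k.2.1) p.1) (S'.α_smul (k.1.2, k.2.2) p.2)

/-- The triple from `X/G` to `Y/H` given by an isomorphism of groups `f : G → H` and a bijection
`t : X → Y` with `t (g x) = f g (t x)`: it is `(H × Y, (h, y) ↦ y, (h, y) ↦ t⁻¹ (h⁻¹ y))` with the
action `(h₁, g) (h, y) = (h₁ h (f g)⁻¹, h₁ y)`. -/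
def ofEquiv (f : A.Grp ≃* B.Grp) (t : A.Pts ≃ B.Pts)
    (ht : ∀ (g : A.Grp) (x : A.Pts), t (g • x) = f g • t x) : Span A B where
  U := B.Grp × B.Pts
  action :=
    { smul := fun k p => (k.1 * p.1 * (f k.2)⁻¹, k.1 • p.2)
      one_smul := fun p => Prod.ext
        (show 1 * p.1 * (f 1)⁻¹ = p.1 by simp) (one_smul _ p.2)
      mul_smul := fun k l p => Prod.ext
        (show k.1 * l.1 * p.1 * (f (k.2 * l.2))⁻¹
            = k.1 * (l.1 * p.1 * (f l.2)⁻¹) * (f k.2)⁻¹ by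
          simp [mul_assoc]) (mul_smul k.1 l.1 p.2) }
  β := fun p => p.2
  α := fun p => t.symm (p.1⁻¹ • p.2)
  β_smul := fun _ _ => rfl
  α_smul := fun k p =>
    show t.symm ((k.1 * p.1 * (f k.2)⁻¹)⁻¹ • (k.1 • p.2)) = k.2 • t.symm (p.1⁻¹ • p.2) by
      rw [Equiv.symm_apply_eq, ht, Equiv.apply_symm_apply]
      simp [mul_smul]

/-- The canonical triple from `(X/G ⊗ Y/H) ⊗ Z/K` to `X/G ⊗ (Y/H ⊗ Z/K)`. -/
def assoc (A B C : GFrac.{u} R) :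
    Span (tensObj (tensObj A B) C) (tensObj A (tensObj B C)) :=
  ofEquiv (MulEquiv.prodAssoc : (A.Grp × B.Grp) × C.Grp ≃* A.Grp × B.Grp × C.Grp)
    (Equiv.prodAssoc A.Pts B.Pts C.Pts) (fun _ _ => rfl)

/-- The canonical triple from `{•}/1 ⊗ X/G` to `X/G`. -/
def leftUnit (A : GFrac.{u} R) : Span (tensObj unitObj A) A :=
  ofEquiv (MulEquiv.uniqueProd : PUnit.{u + 1} × A.Grp ≃* A.Grp)
    (Equiv.punitProd A.Pts) (fun _ _ => rfl)

/-- The canonical triple from `X/G ⊗ {•}/1` to `X/G`. -/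
def rightUnit (A : GFrac.{u} R) : Span (tensObj A unitObj) A :=
  ofEquiv (MulEquiv.prodUnique : A.Grp × PUnit.{u + 1} ≃* A.Grp)
    (Equiv.prodPUnit A.Pts) (fun _ _ => rfl)

/-- The canonical triple from `X/G ⊗ Y/H` to `Y/H ⊗ X/G`. -/
def swap (A B : GFrac.{u} R) : Span (tensObj A B) (tensObj B A) :=
  ofEquiv (MulEquiv.prodComm : A.Grp × B.Grp ≃* B.Grp × A.Grp)
    (Equiv.prodComm A.Pts B.Pts) (fun _ _ => rfl)

end Span

/-! ### Morphisms: the groups `RB^{H, G}(Y, X)` -/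

/-- The defining relations of the Grothendieck group: isomorphic triples are equal, and disjoint
union is addition. -/
inductive BurnsideRel (A B : GFrac.{u} R) : FreeAbelianGroup (Span A B) → Prop
  | iso (S T : Span A B) (h : S.IsIso T) :
      BurnsideRel A B (FreeAbelianGroup.of S - FreeAbelianGroup.of T)
  | add (S T : Span A B) :
      BurnsideRel A B (FreeAbelianGroup.of (S.disjUnion T)
        - (FreeAbelianGroup.of S + FreeAbelianGroup.of T))

/-- The group `B^{H, G}(Y, X)`, for `A = X/G` and `B = Y/H`: the Grothendieck group of
`(H × G)`-sets over `Y × X`. -/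
abbrev Burnside (A B : GFrac.{u} R) : Type (u + 1) :=
  FreeAbelianGroup (Span A B) ⧸ AddSubgroup.closure {x | BurnsideRel A B x}

variable (R) in
/-- The `R`-module `RB^{H, G}(Y, X) = R ⊗_ℤ B^{H, G}(Y, X)` of morphisms from `A = X/G` to
`B = Y/H`. -/
abbrev Mor (A B : GFrac.{u} R) : Type (max v (u + 1)) :=
  R ⊗[ℤ] Burnside A B

/-- The class `⟨U, β, α⟩` of a triple in `RB^{H, G}(Y, X)`. -/
def Span.cls {A B : GFrac.{u} R} (S : Span A B) : Mor R A B :=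
  (1 : R) ⊗ₜ[ℤ] (QuotientAddGroup.mk (FreeAbelianGroup.of S) : Burnside A B)

/-! ### Structures built from a bilinear composition -/

variable (R) in
/-- The type of families of `R`-bilinear maps
`RB^{K, H}(Z, Y) × RB^{H, G}(Y, X) → RB^{K, G}(Z, X)`. -/
abbrev Composition : Type (max v (u + 1)) :=
  ∀ A B C : GFrac.{u} R, Mor R B C →ₗ[R] Mor R A B →ₗ[R] Mor R A C

/-- The category with objects the fractions `X/G`, morphisms the modules `RB^{H, G}(Y, X)`, the
given composition and the identities `⟨G × X, (g, x) ↦ x, (g, x) ↦ g⁻¹ x⟩`, once the laws of a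
category are known to hold. -/
abbrev category (c : Composition.{u} R)
    (id_comp : ∀ (A B : GFrac.{u} R) (f : Mor R A B), c A B B (Span.id B).cls f = f)
    (comp_id : ∀ (A B : GFrac.{u} R) (f : Mor R A B), c A A B f (Span.id A).cls = f)
    (assoc : ∀ (A B C D : GFrac.{u} R) (f : Mor R A B) (g : Mor R B C) (h : Mor R C D),
      c A B D (c B C D h g) f = c A C D h (c A B C g f)) :
    Category.{max v (u + 1)} (GFrac.{u} R) where
  Hom A B := Mor R A B
  id A := (Span.id A).cls
  comp f g := c _ _ _ g f
  id_comp f := comp_id _ _ f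
  comp_id f := id_comp _ _ f
  assoc f g h := (assoc _ _ _ _ f g h).symm

/-- The preadditive structure, with the addition of the modules `RB^{H, G}(Y, X)`. -/
abbrev preadditive (c : Composition.{u} R)
    (id_comp : ∀ (A B : GFrac.{u} R) (f : Mor R A B), c A B B (Span.id B).cls f = f)
    (comp_id : ∀ (A B : GFrac.{u} R) (f : Mor R A B), c A A B f (Span.id A).cls = f)
    (assoc : ∀ (A B C D : GFrac.{u} R) (f : Mor R A B) (g : Mor R B C) (h : Mor R C D),
      c A B D (c B C D h g) f = c A C D h (c A B C g f)) :
    letI := category c id_comp comp_id assoc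
    Preadditive (GFrac.{u} R) :=
  letI := category c id_comp comp_id assoc
  { homGroup := fun A B => inferInstanceAs (AddCommGroup (Mor R A B))
    add_comp := fun A B C (f f' : Mor R A B) (g : Mor R B C) => (c A B C g).map_add f f'
    comp_add := fun A B C (f : Mor R A B) (g g' : Mor R B C) =>
      LinearMap.map_add₂ (c A B C) g g' f }

section Structures

variable [Category.{max v (u + 1)} (GFrac.{u} R)]

/-- The functor to the opposite category that is the identity on objects and `D` on morphisms. -/
abbrev dualFunctor (D : ∀ {A B : GFrac.{u} R}, (A ⟶ B) → (B ⟶ A))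
    (D_id : ∀ A : GFrac.{u} R, D (𝟙 A) = 𝟙 A)
    (D_comp : ∀ {A B C : GFrac.{u} R} (f : A ⟶ B) (g : B ⟶ C), D (f ≫ g) = D g ≫ D f) :
    GFrac.{u} R ⥤ (GFrac.{u} R)ᵒᵖ where
  obj := Opposite.op
  map f := (D f).op
  map_id A := by rw [D_id]; rfl
  map_comp f g := by rw [D_comp]; rfl

/-- The data of a monoidal structure on a category of fractions, with `X/G ⊗ Y/H` and the unit
`{•}/1` as above, from a tensor product of morphisms, associators and unitors. -/
abbrev monoidalStruct
    (T : ∀ {A B A' B' : GFrac.{u} R}, (A ⟶ B) → (A' ⟶ B') → (tensObj A A' ⟶ tensObj B B'))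
    (a : ∀ A B C : GFrac.{u} R, tensObj (tensObj A B) C ≅ tensObj A (tensObj B C))
    (l : ∀ A : GFrac.{u} R, tensObj unitObj A ≅ A)
    (r : ∀ A : GFrac.{u} R, tensObj A unitObj ≅ A) :
    MonoidalCategoryStruct (GFrac.{u} R) where
  tensorObj := tensObj
  tensorUnit := unitObj
  tensorHom f g := T f g
  whiskerLeft A _ _ f := T (𝟙 A) f
  whiskerRight f A := T f (𝟙 A)
  associator := a
  leftUnitor := l
  rightUnitor := r

/-- The data `S` satisfies the axioms of a monoidal category. -/
def IsMonoidal (S : MonoidalCategoryStruct (GFrac.{u} R)) : Prop :=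
  ∃ M : MonoidalCategory (GFrac.{u} R), M.toMonoidalCategoryStruct = S

/-- The monoidal category with the given data, once the axioms are known to hold. -/
abbrev monoidal (S : MonoidalCategoryStruct (GFrac.{u} R)) (hS : IsMonoidal S) :
    MonoidalCategory (GFrac.{u} R) where
  toMonoidalCategoryStruct := S
  tensorHom_def := by obtain ⟨M, rfl⟩ := hS; exact M.tensorHom_def
  id_tensorHom_id := by obtain ⟨M, rfl⟩ := hS; exact M.id_tensorHom_id
  tensorHom_comp_tensorHom := by obtain ⟨M, rfl⟩ := hS; exact M.tensorHom_comp_tensorHom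
  whiskerLeft_id := by obtain ⟨M, rfl⟩ := hS; exact M.whiskerLeft_id
  id_whiskerRight := by obtain ⟨M, rfl⟩ := hS; exact M.id_whiskerRight
  associator_naturality := by obtain ⟨M, rfl⟩ := hS; exact M.associator_naturality
  leftUnitor_naturality := by obtain ⟨M, rfl⟩ := hS; exact M.leftUnitor_naturality
  rightUnitor_naturality := by obtain ⟨M, rfl⟩ := hS; exact M.rightUnitor_naturality
  pentagon := by obtain ⟨M, rfl⟩ := hS; exact M.pentagon
  triangle := by obtain ⟨M, rfl⟩ := hS; exact M.triangle

end Structures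

end GFrac

namespace GFrac

variable {R : Type v} [CommRing R]

variable {A B C D A' B' C' A'' B'' : GFrac.{u} R}

namespace Span

/-! ### Isomorphisms of triples -/

/-! Read `X/G` as its action groupoid, with points `X` and an arrow `x ⟶ g x` for each `g`. An `(H ×
G)`-set over `Y × X` is then a biset between two such groupoids, its fibre over `(y, x)` being the
set of elements going from `x` to `y`. The `H`-orbits of the pullback form the tensor product of
bisets over the middle groupoid, and the identity triple is the biset of arrows: `(g, x)` is the
arrow `g⁻¹ x ⟶ x`. The theorem transfers the usual calculus of bisets to Grothendieck groups.

At the level of triples each law is an isomorphism. Most come from one principle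
(`isIso_of_surjective`, `comp_isIso_of`): two triples are isomorphic once they are compatibly
quotients of the same set by the same relation. This gives associativity (`comp_assoc`), additivity
(`disjUnion_comp`), duality (`op_comp`) and interchange (`comp_tens_comp`). Classes of triples span
the morphism modules and all operations are linear in each variable, so `Mor.lift`, `Mor.lift₂` and
`Mor.induction` carry these laws over to morphisms.

For biproducts, the groupoid of `((X × H) ⊔ (G × Y))/(G × H)` is equivalent to the disjoint union of
the groupoids of `X/G` and `Y/H`. The inclusions are fully faithful, with disjoint essential images
that together exhaust the points. Each inclusion gives a triple `ofHom`, its opposite gives the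
projection, and the biproduct equations follow from `op_ofHom_comp_ofHom`, `ofHom_comp_op_ofHom` and
`isEmpty_op_ofHom_comp_ofHom`.

For the monoidal structure, composition with `ofEquiv` is transport of structure, so naturality
reduces to a bijection of underlying sets (`ofEquiv_naturality`). The coherence axioms reduce to
identities between the group isomorphisms and bijections themselves. -/

theorem IsIso.refl (S : Span A B) : S.IsIso S :=
  ⟨Equiv.refl _, fun _ _ => rfl, fun _ => rfl, fun _ => rfl⟩

theorem IsIso.symm {S T : Span A B} (h : S.IsIso T) : T.IsIso S := by
  obtain ⟨e, h₁, h₂, h₃⟩ := h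
  refine ⟨e.symm, fun k u => ?_, fun u => ?_, fun u => ?_⟩
  · rw [Equiv.symm_apply_eq, h₁, Equiv.apply_symm_apply]
  · rw [← h₂, Equiv.apply_symm_apply]
  · rw [← h₃, Equiv.apply_symm_apply]

theorem IsIso.trans {S T W : Span A B} (h : S.IsIso T) (h' : T.IsIso W) : S.IsIso W := by
  obtain ⟨e, h₁, h₂, h₃⟩ := h
  obtain ⟨e', h₁', h₂', h₃'⟩ := h'
  exact ⟨e.trans e', fun k u => by simp [h₁, h₁'], fun u => by simp [h₂, h₂'],
    fun u => by simp [h₃, h₃']⟩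

/-- Two triples are isomorphic if their underlying sets are quotients of a common set by the same
equivalence relation, compatibly with all structure. -/
theorem isIso_of_surjective {S T : Span A B} {P : Type*} (p : P → S.U) (q : P → T.U)
    (hp : Function.Surjective p) (hq : Function.Surjective q)
    (hpq : ∀ x y, p x = p y ↔ q x = q y)
    (hk : ∀ (k : B.Grp × A.Grp) x, ∃ y, p y = k • p x ∧ q y = k • q x)
    (hβ : ∀ x, T.β (q x) = S.β (p x)) (hα : ∀ x, T.α (q x) = S.α (p x)) : S.IsIso T := by
  -- The bijection sends `s` to the `q`-image of a chosen `p`-preimage; since `p` and `q` have the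
  -- same fibres, the choice does not matter.
  have key : ∀ x, q (Function.surjInv hp (p x)) = q x := fun x =>
    (hpq _ x).1 (Function.surjInv_eq hp (p x))
  let e : S.U ≃ T.U := Equiv.ofBijective (fun s => q (Function.surjInv hp s)) (by
    constructor
    · intro s s' h
      simpa only [Function.surjInv_eq] using (hpq _ _).2 h
    · intro t
      obtain ⟨x, rfl⟩ := hq t
      exact ⟨p x, key x⟩)
  have he : ∀ x, e (p x) = q x := key
  refine ⟨e, fun k u => ?_, fun u => ?_, fun u => ?_⟩
  · obtain ⟨x, rfl⟩ := hp u
    obtain ⟨y, hy₁, hy₂⟩ := hk k x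
    rw [he, ← hy₁, he, hy₂]
  · obtain ⟨x, rfl⟩ := hp u
    rw [he, hβ]
  · obtain ⟨x, rfl⟩ := hp u
    rw [he, hα]

/-- Two triples are isomorphic if there is a bijective morphism between them. -/
theorem isIso_of_bijective {S T : Span A B} (q : S.U → T.U) (hq : Function.Bijective q)
    (hk : ∀ (k : B.Grp × A.Grp) x, q (k • x) = k • q x)
    (hβ : ∀ x, T.β (q x) = S.β x) (hα : ∀ x, T.α (q x) = S.α x) : S.IsIso T :=
  ⟨Equiv.ofBijective q hq, hk, hβ, hα⟩

/-! ### Elements of composites -/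

/-- The element `[v, u]` of the composite. -/
def glue (V : Span B C) (U : Span A B) (v : V.U) (u : U.U) (h : V.α v = U.β u) : (V.comp U).U :=
  Quotient.mk (pullbackSetoid V U) ⟨(v, u), h⟩

theorem α_smul_eq_β_smul {V : Span B C} {U : Span A B} {v : V.U} {u : U.U}
    (h : V.α v = U.β u) (c : C.Grp) (a : A.Grp) :
    V.α ((c, (1 : B.Grp)) • v) = U.β (((1 : B.Grp), a) • u) := by
  rw [V.α_smul, U.β_smul, h]

theorem glue_surjective (V : Span B C) (U : Span A B) (w : (V.comp U).U) :
    ∃ v u h, glue V U v u h = w := by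
  obtain ⟨⟨⟨v, u⟩, h⟩⟩ := w
  exact ⟨v, u, h, rfl⟩

/-- The substitution `b = h⁻¹` turns the orbit relation of the right action into one that is free of
inverses. -/
theorem glue_eq_iff {V : Span B C} {U : Span A B} {v v' : V.U} {u u' : U.U}
    {h : V.α v = U.β u} {h' : V.α v' = U.β u'} :
    glue V U v u h = glue V U v' u' h' ↔
      ∃ b : B.Grp, v' = ((1 : C.Grp), b) • v ∧ u' = (b, (1 : A.Grp)) • u := by
  refine Quotient.eq.trans ⟨?_, ?_⟩
  · rintro ⟨b, h₁, h₂⟩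
    exact ⟨b⁻¹, h₁, h₂⟩
  · rintro ⟨b, h₁, h₂⟩
    exact ⟨b⁻¹, by simpa using h₁, by simpa using h₂⟩

theorem smul_glue {V : Span B C} {U : Span A B} (c : C.Grp) (a : A.Grp) {v : V.U} {u : U.U}
    (h : V.α v = U.β u) :
    (c, a) • glue V U v u h = glue V U ((c, (1 : B.Grp)) • v) (((1 : B.Grp), a) • u)
      (α_smul_eq_β_smul h c a) :=
  rfl

/-- Absorbs the outer action into the balancing relation; this is what unfolds nested orbits in the
proof of associativity. -/
theorem glue_eq_smul_iff {V : Span B C} {U : Span A B} {v v' : V.U} {u u' : U.U}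
    {h : V.α v = U.β u} {h' : V.α v' = U.β u'} (c : C.Grp) (a : A.Grp) :
    glue V U v' u' h' = (c, a) • glue V U v u h ↔
      ∃ b : B.Grp, v' = (c, b) • v ∧ u' = (b, a) • u := by
  rw [smul_glue, eq_comm, glue_eq_iff]
  simp only [smul_smul, Prod.mk_mul_mk, one_mul, mul_one]

/-- A composite is isomorphic to a given triple. -/
theorem comp_isIso_of {V : Span B C} {U : Span A B} {T : Span A C} (φ : V.U → U.U → T.U)
    (surj : ∀ t, ∃ v u, V.α v = U.β u ∧ φ v u = t)
    (bal : ∀ (b : B.Grp) v u, V.α v = U.β u →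
      φ (((1 : C.Grp), b) • v) ((b, (1 : A.Grp)) • u) = φ v u)
    (inj : ∀ v u v' u', V.α v = U.β u → V.α v' = U.β u' → φ v u = φ v' u' →
      ∃ b : B.Grp, v' = ((1 : C.Grp), b) • v ∧ u' = (b, (1 : A.Grp)) • u)
    (hk : ∀ (c : C.Grp) (a : A.Grp) v u, V.α v = U.β u →
      φ ((c, (1 : B.Grp)) • v) (((1 : B.Grp), a) • u) = (c, a) • φ v u)
    (hβ : ∀ v u, V.α v = U.β u → T.β (φ v u) = V.β v)
    (hα : ∀ v u, V.α v = U.β u → T.α (φ v u) = U.α u) : (V.comp U).IsIso T := by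
  refine isIso_of_surjective (P := Pullback V U) (fun x => glue V U x.1.1 x.1.2 x.2)
    (fun x => φ x.1.1 x.1.2) ?_ ?_ ?_ ?_ ?_ ?_
  · intro w
    obtain ⟨v, u, h, rfl⟩ := glue_surjective V U w
    exact ⟨⟨(v, u), h⟩, rfl⟩
  · intro t
    obtain ⟨v, u, h, rfl⟩ := surj t
    exact ⟨⟨(v, u), h⟩, rfl⟩
  · rintro ⟨⟨v, u⟩, h⟩ ⟨⟨v', u'⟩, h'⟩
    refine glue_eq_iff.trans ⟨?_, inj _ _ _ _ h h'⟩
    rintro ⟨b, rfl, rfl⟩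
    exact (bal b v u h).symm
  · rintro ⟨c, a⟩ ⟨⟨v, u⟩, h⟩
    exact ⟨⟨((c, (1 : B.Grp)) • v, ((1 : B.Grp), a) • u), α_smul_eq_β_smul h c a⟩, rfl, hk c a v u h⟩
  · rintro ⟨⟨v, u⟩, h⟩
    exact hβ v u h
  · rintro ⟨⟨v, u⟩, h⟩
    exact hα v u h

/-! ### Composition of triples -/

theorem comp_congr {U U' : Span A B} {V V' : Span B C} (hU : U.IsIso U') (hV : V.IsIso V') :
    (V.comp U).IsIso (V'.comp U') := by
  obtain ⟨e, e₁, e₂, e₃⟩ := hU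
  obtain ⟨d, d₁, d₂, d₃⟩ := hV
  refine isIso_of_surjective (P := Pullback V U) (fun x => glue V U x.1.1 x.1.2 x.2)
    (fun x => glue V' U' (d x.1.1) (e x.1.2) (by rw [d₃, e₂]; exact x.2)) ?_ ?_ ?_ ?_ ?_ ?_
  · intro w
    obtain ⟨v, u, h, rfl⟩ := glue_surjective V U w
    exact ⟨⟨(v, u), h⟩, rfl⟩
  · intro w
    obtain ⟨v, u, h, rfl⟩ := glue_surjective V' U' w
    obtain ⟨v, rfl⟩ := d.surjective v
    obtain ⟨u, rfl⟩ := e.surjective u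
    exact ⟨⟨(v, u), by rw [← d₃, ← e₂, h]⟩, rfl⟩
  · intro x y
    rw [glue_eq_iff, glue_eq_iff]
    simp only [← d₁, ← e₁, EmbeddingLike.apply_eq_iff_eq]
  · rintro ⟨c, a⟩ ⟨⟨v, u⟩, h⟩
    refine ⟨⟨((c, (1 : B.Grp)) • v, ((1 : B.Grp), a) • u), α_smul_eq_β_smul h c a⟩, rfl, ?_⟩
    simp only [smul_glue, d₁, e₁]
  · intro x
    exact d₂ _
  · intro x
    exact e₃ _

theorem disjUnion_congr {S S' T T' : Span A B} (h : S.IsIso S') (h' : T.IsIso T') :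
    (S.disjUnion T).IsIso (S'.disjUnion T') := by
  obtain ⟨e, e₁, e₂, e₃⟩ := h
  obtain ⟨d, d₁, d₂, d₃⟩ := h'
  refine ⟨Equiv.sumCongr e d, ?_, ?_, ?_⟩
  · rintro k (u | u)
    · exact congrArg Sum.inl (e₁ k u)
    · exact congrArg Sum.inr (d₁ k u)
  · rintro (u | u)
    · exact e₂ u
    · exact d₂ u
  · rintro (u | u)
    · exact e₃ u
    · exact d₃ u

theorem disjUnion_comp (V V' : Span B C) (U : Span A B) :
    ((V.disjUnion V').comp U).IsIso ((V.comp U).disjUnion (V'.comp U)) := by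
  refine IsIso.symm (isIso_of_surjective (P := Pullback V U ⊕ Pullback V' U)
    (Sum.elim (fun x => Sum.inl (glue V U x.1.1 x.1.2 x.2))
      (fun x => Sum.inr (glue V' U x.1.1 x.1.2 x.2)))
    (Sum.elim (fun x => glue (V.disjUnion V') U (Sum.inl x.1.1) x.1.2 x.2)
      (fun x => glue (V.disjUnion V') U (Sum.inr x.1.1) x.1.2 x.2)) ?_ ?_ ?_ ?_ ?_ ?_)
  · rintro (w | w)
    · obtain ⟨v, u, h, rfl⟩ := glue_surjective _ _ w
      exact ⟨Sum.inl ⟨(v, u), h⟩, rfl⟩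
    · obtain ⟨v, u, h, rfl⟩ := glue_surjective _ _ w
      exact ⟨Sum.inr ⟨(v, u), h⟩, rfl⟩
  · intro w
    obtain ⟨v | v, u, h, rfl⟩ := glue_surjective _ _ w
    · exact ⟨Sum.inl ⟨(v, u), h⟩, rfl⟩
    · exact ⟨Sum.inr ⟨(v, u), h⟩, rfl⟩
  · rintro (x | x) (y | y)
    · refine Sum.inl_injective.eq_iff.trans (glue_eq_iff.trans (Iff.trans ?_ glue_eq_iff.symm))
      exact exists_congr fun b => and_congr_left' Sum.inl_injective.eq_iff.symm
    · refine iff_of_false Sum.inl_ne_inr fun h => ?_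
      obtain ⟨b, h, -⟩ := glue_eq_iff.1 h
      exact Sum.inr_ne_inl h
    · refine iff_of_false Sum.inr_ne_inl fun h => ?_
      obtain ⟨b, h, -⟩ := glue_eq_iff.1 h
      exact Sum.inl_ne_inr h
    · refine Sum.inr_injective.eq_iff.trans (glue_eq_iff.trans (Iff.trans ?_ glue_eq_iff.symm))
      exact exists_congr fun b => and_congr_left' Sum.inr_injective.eq_iff.symm
  · rintro ⟨c, a⟩ (⟨⟨v, u⟩, h⟩ | ⟨⟨v, u⟩, h⟩)
    · exact ⟨Sum.inl ⟨((c, (1 : B.Grp)) • v, ((1 : B.Grp), a) • u), α_smul_eq_β_smul h c a⟩, rfl, rfl⟩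
    · exact ⟨Sum.inr ⟨((c, (1 : B.Grp)) • v, ((1 : B.Grp), a) • u), α_smul_eq_β_smul h c a⟩, rfl, rfl⟩
  · rintro (x | x) <;> rfl
  · rintro (x | x) <;> rfl

/-! ### The opposite triple -/

theorem op_op (S : Span A B) : S.op.op = S :=
  rfl

theorem op_congr {S T : Span A B} (h : S.IsIso T) : S.op.IsIso T.op := by
  obtain ⟨e, e₁, e₂, e₃⟩ := h
  exact ⟨e, fun k u => e₁ (k.2, k.1) u, e₃, e₂⟩

theorem op_disjUnion (S T : Span A B) : (S.disjUnion T).op.IsIso (S.op.disjUnion T.op) :=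
  ⟨Equiv.refl _, by rintro k (u | u) <;> rfl, fun _ => rfl, fun _ => rfl⟩

/-- Both sides consist of orbits on one pullback with its two coordinates exchanged; the balancing
relation is symmetric in them. -/
theorem op_comp (V : Span B C) (U : Span A B) : (U.op.comp V.op).IsIso (V.comp U).op := by
  refine isIso_of_surjective (P := Pullback V U)
    (fun x => glue U.op V.op x.1.2 x.1.1 x.2.symm) (fun x => glue V U x.1.1 x.1.2 x.2)
    ?_ ?_ ?_ ?_ ?_ ?_
  · intro w
    obtain ⟨u, v, h, rfl⟩ := glue_surjective _ _ w
    exact ⟨⟨(v, u), h.symm⟩, rfl⟩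
  · intro w
    obtain ⟨v, u, h, rfl⟩ := glue_surjective V U w
    exact ⟨⟨(v, u), h⟩, rfl⟩
  · intro x y
    refine glue_eq_iff.trans (Iff.trans ?_ glue_eq_iff.symm)
    exact exists_congr fun b => and_comm
  · rintro ⟨a, c⟩ ⟨⟨v, u⟩, h⟩
    exact ⟨⟨((c, (1 : B.Grp)) • v, ((1 : B.Grp), a) • u), α_smul_eq_β_smul h c a⟩, rfl, rfl⟩
  · intro x
    rfl
  · intro x
    rfl

theorem comp_disjUnion (V : Span B C) (U U' : Span A B) :
    (V.comp (U.disjUnion U')).IsIso ((V.comp U).disjUnion (V.comp U')) := by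
  -- Additivity on the right is the dual of additivity on the left; `op` is an involution by
  -- definition, so double opposites vanish.
  have h₁ := op_comp (U.disjUnion U').op V.op
  have h₂ := op_congr ((comp_congr (IsIso.refl V.op) (op_disjUnion U U')).trans
    (disjUnion_comp U.op U'.op V.op))
  have h₃ := (op_disjUnion (U.op.comp V.op) (U'.op.comp V.op)).trans
    (disjUnion_congr (op_comp U.op V.op).symm (op_comp U'.op V.op).symm)
  exact h₁.trans (h₂.trans h₃)

/-- Both bracketings are the quotient of the triple pullback by the simultaneous balancing action of
the two middle groups. Only the order in which the two balancing elements are found differs. -/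
theorem comp_assoc (W : Span C D) (V : Span B C) (U : Span A B) :
    ((W.comp V).comp U).IsIso (W.comp (V.comp U)) := by
  refine isIso_of_surjective
    (P := {x : W.U × V.U × U.U // W.α x.1 = V.β x.2.1 ∧ V.α x.2.1 = U.β x.2.2})
    (fun x => glue (W.comp V) U (glue W V x.1.1 x.1.2.1 x.2.1) x.1.2.2 x.2.2)
    (fun x => glue W (V.comp U) x.1.1 (glue V U x.1.2.1 x.1.2.2 x.2.2) x.2.1) ?_ ?_ ?_ ?_ ?_ ?_
  · intro w
    obtain ⟨w, u, h, rfl⟩ := glue_surjective _ _ w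
    obtain ⟨w, v, h', rfl⟩ := glue_surjective _ _ w
    exact ⟨⟨(w, v, u), h', h⟩, rfl⟩
  · intro w
    obtain ⟨w, u, h, rfl⟩ := glue_surjective _ _ w
    obtain ⟨v, u, h', rfl⟩ := glue_surjective _ _ u
    exact ⟨⟨(w, v, u), h, h'⟩, rfl⟩
  · rintro ⟨⟨w, v, u⟩, h₁, h₂⟩ ⟨⟨w', v', u'⟩, h₁', h₂'⟩
    constructor
    · intro h
      obtain ⟨b, h₃, h₄⟩ := glue_eq_iff.1 h
      obtain ⟨c, h₅, h₆⟩ := (glue_eq_smul_iff _ _).1 h₃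
      exact glue_eq_iff.2 ⟨c, h₅, (glue_eq_smul_iff _ _).2 ⟨b, h₆, h₄⟩⟩
    · intro h
      obtain ⟨c, h₃, h₄⟩ := glue_eq_iff.1 h
      obtain ⟨b, h₅, h₆⟩ := (glue_eq_smul_iff _ _).1 h₄
      exact glue_eq_iff.2 ⟨b, (glue_eq_smul_iff _ _).2 ⟨c, h₃, h₅⟩, h₆⟩
  · rintro ⟨d, a⟩ ⟨⟨w, v, u⟩, h₁, h₂⟩
    -- The trivial factor on `v` is kept because the action on the nested orbit produces it; with it
    -- both equations hold by definition.
    exact ⟨⟨((d, (1 : C.Grp)) • w, ((1 : C.Grp), (1 : B.Grp)) • v, ((1 : B.Grp), a) • u),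
      α_smul_eq_β_smul h₁ d 1, α_smul_eq_β_smul h₂ 1 a⟩, rfl, rfl⟩
  · intro x
    rfl
  · intro x
    rfl

/-! ### Triples induced by isomorphisms -/

/-- Composition with an isomorphism on the right is restriction along it. -/
theorem comp_ofEquiv (f : A.Grp ≃* B.Grp) (t : A.Pts ≃ B.Pts)
    (ht : ∀ (g : A.Grp) (x : A.Pts), t (g • x) = f g • t x) {S : Span B C} {T : Span A C}
    (ψ : S.U ≃ T.U) (hψ : ∀ (c : C.Grp) (a : A.Grp) u, ψ ((c, f a) • u) = (c, a) • ψ u)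
    (hβ : ∀ u, T.β (ψ u) = S.β u) (hα : ∀ u, t (T.α (ψ u)) = S.α u) :
    (S.comp (ofEquiv f t ht)).IsIso T := by
  -- Balancing by `h⁻¹` moves `u = (h, y)` to one with group coordinate `1`, and `v` to `(1, h⁻¹) •
  -- v`, which then labels the orbit.
  refine comp_isIso_of (fun v u => ψ (((1 : C.Grp), u.1⁻¹) • v)) ?_ ?_ ?_ ?_ ?_ ?_
  · intro w
    refine ⟨ψ.symm w, (1, S.α (ψ.symm w)), rfl, ?_⟩
    simp [← Prod.one_eq_mk]
  · rintro b v ⟨h, y⟩ hv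
    change ψ ((1, (b * h * (f 1)⁻¹)⁻¹) • (1, b) • v) = ψ ((1, h⁻¹) • v)
    rw [smul_smul]
    simp
  · rintro v ⟨h, y⟩ v' ⟨h', y'⟩ (hv : S.α v = y) (hv' : S.α v' = y')
      (e : ψ ((1, h⁻¹) • v) = ψ ((1, h'⁻¹) • v'))
    have e' := ψ.injective e
    rw [← inv_smul_eq_iff, smul_smul] at e'
    have e'' : v' = ((1 : C.Grp), h' * h⁻¹) • v := by simpa using e'.symm
    refine ⟨h' * h⁻¹, e'', ?_⟩
    refine Prod.ext (show h' = h' * h⁻¹ * h * (f 1)⁻¹ by simp) ?_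
    change y' = (h' * h⁻¹) • y
    rw [← hv, ← hv', e'', S.α_smul]
  · rintro c a v ⟨h, y⟩ hv
    change ψ ((1, (1 * h * (f a)⁻¹)⁻¹) • (c, 1) • v) = (c, a) • ψ ((1, h⁻¹) • v)
    rw [← hψ, smul_smul, smul_smul]
    simp
  · rintro v ⟨h, y⟩ hv
    rw [hβ, S.β_smul, one_smul]
  · rintro v ⟨h, y⟩ (hv : S.α v = y)
    change _ = t.symm (h⁻¹ • y)
    rw [← hv, Equiv.eq_symm_apply, hα, S.α_smul]

/-- Composition with an isomorphism on the left is transport along it. -/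
theorem ofEquiv_comp (f : B.Grp ≃* C.Grp) (t : B.Pts ≃ C.Pts)
    (ht : ∀ (g : B.Grp) (x : B.Pts), t (g • x) = f g • t x) {S : Span A B} {T : Span A C}
    (ψ : S.U ≃ T.U) (hψ : ∀ (b : B.Grp) (a : A.Grp) u, ψ ((b, a) • u) = (f b, a) • ψ u)
    (hβ : ∀ u, T.β (ψ u) = t (S.β u)) (hα : ∀ u, T.α (ψ u) = S.α u) :
    ((ofEquiv f t ht).comp S).IsIso T := by
  -- Balancing by `f⁻¹ h` moves `v = (h, y)` to `(1, y)` and `u` to `(f⁻¹ h, 1) • u`, whose image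
  -- under `ψ` is `(h, 1) • ψ u`.
  refine comp_isIso_of (fun v u => (v.1, (1 : A.Grp)) • ψ u) ?_ ?_ ?_ ?_ ?_ ?_
  · intro w
    refine ⟨(1, t (S.β (ψ.symm w))), ψ.symm w, ?_, ?_⟩
    · change t.symm ((1 : C.Grp)⁻¹ • _) = _
      simp
    · simp [← Prod.one_eq_mk]
  · rintro b ⟨h, y⟩ u hv
    change (1 * h * (f b)⁻¹, (1 : A.Grp)) • ψ ((b, 1) • u) = (h, (1 : A.Grp)) • ψ u
    rw [hψ, smul_smul]
    simp
  · rintro ⟨h, y⟩ u ⟨h', y'⟩ u' (hv : t.symm (h⁻¹ • y) = S.β u)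
      (hv' : t.symm (h'⁻¹ • y') = S.β u')
      (e : (h, (1 : A.Grp)) • ψ u = (h', (1 : A.Grp)) • ψ u')
    rw [eq_comm, ← eq_inv_smul_iff, smul_smul] at e
    have e' : u' = (f.symm (h'⁻¹ * h), (1 : A.Grp)) • u := by
      apply ψ.injective
      rw [hψ, e]
      simp
    rw [Equiv.symm_apply_eq, inv_smul_eq_iff] at hv hv'
    refine ⟨f.symm (h'⁻¹ * h), Prod.ext ?_ ?_, e'⟩
    · change h' = 1 * h * (f (f.symm (h'⁻¹ * h)))⁻¹
      simp
    · change y' = (1 : C.Grp) • y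
      rw [hv, hv', e', S.β_smul, ht]
      simp [smul_smul]
  · rintro c a ⟨h, y⟩ u hv
    change (c * h * (f 1)⁻¹, (1 : A.Grp)) • ψ ((1, a) • u) = (c, a) • (h, (1 : A.Grp)) • ψ u
    rw [hψ, smul_smul, smul_smul]
    simp
  · rintro ⟨h, y⟩ u (hv : t.symm (h⁻¹ • y) = S.β u)
    rw [Equiv.symm_apply_eq, inv_smul_eq_iff] at hv
    change _ = y
    rw [hv, T.β_smul, hβ]
  · rintro ⟨h, y⟩ u hv
    rw [T.α_smul, hα, one_smul]

/-- The restriction of a triple along an isomorphism. -/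
def restrict (S : Span B C) (f : A.Grp ≃* B.Grp) (t : A.Pts ≃ B.Pts)
    (ht : ∀ (g : A.Grp) (x : A.Pts), t (g • x) = f g • t x) : Span A C where
  U := S.U
  action := MulAction.compHom S.U (MonoidHom.prodMap (MonoidHom.id C.Grp) f.toMonoidHom)
  β := S.β
  α := fun u => t.symm (S.α u)
  β_smul := fun k u => S.β_smul (k.1, f k.2) u
  α_smul := fun k u => by
    rw [Equiv.symm_apply_eq, ht, Equiv.apply_symm_apply]
    exact S.α_smul (k.1, f k.2) u

/-- Naturality of the triples induced by isomorphisms. -/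
theorem ofEquiv_naturality (f : A.Grp ≃* A'.Grp) (t : A.Pts ≃ A'.Pts)
    (ht : ∀ (g : A.Grp) (x : A.Pts), t (g • x) = f g • t x)
    (f' : B.Grp ≃* B'.Grp) (t' : B.Pts ≃ B'.Pts)
    (ht' : ∀ (g : B.Grp) (x : B.Pts), t' (g • x) = f' g • t' x)
    {S : Span A B} {S' : Span A' B'} (ψ : S.U ≃ S'.U)
    (hψ : ∀ (b : B.Grp) (a : A.Grp) u, ψ ((b, a) • u) = (f' b, f a) • ψ u)
    (hβ : ∀ u, S'.β (ψ u) = t' (S.β u)) (hα : ∀ u, S'.α (ψ u) = t (S.α u)) :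
    ((ofEquiv f' t' ht').comp S).IsIso (S'.comp (ofEquiv f t ht)) := by
  -- Both composites are `S'` restricted along `(f, t)`: the left one through `ψ`, the right one
  -- through the identity map.
  refine (ofEquiv_comp f' t' ht' (T := S'.restrict f t ht) ψ hψ hβ ?_).trans
    (comp_ofEquiv f t ht (Equiv.refl _) ?_ ?_ ?_).symm
  · intro u
    change t.symm (S'.α (ψ u)) = _
    rw [hα, Equiv.symm_apply_apply]
  · intro c a u
    rfl
  · intro u
    rfl
  · intro u
    exact t.apply_symm_apply _

theorem ofEquiv_comp_ofEquiv (f : A.Grp ≃* B.Grp) (t : A.Pts ≃ B.Pts)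
    (ht : ∀ (g : A.Grp) (x : A.Pts), t (g • x) = f g • t x)
    (f' : B.Grp ≃* C.Grp) (t' : B.Pts ≃ C.Pts)
    (ht' : ∀ (g : B.Grp) (x : B.Pts), t' (g • x) = f' g • t' x) :
    ((ofEquiv f' t' ht').comp (ofEquiv f t ht)).IsIso
      (ofEquiv (f.trans f') (t.trans t') (fun g x => by simp [ht, ht'])) := by
  refine ofEquiv_comp f' t' ht' (Equiv.prodCongr f'.toEquiv t') ?_ ?_ ?_
  · rintro b a ⟨h, y⟩
    refine Prod.ext ?_ (ht' b y)
    change f' (b * h * (f a)⁻¹) = f' b * f' h * (f' (f a))⁻¹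
    simp
  · rintro ⟨h, y⟩
    rfl
  · rintro ⟨h, y⟩
    change t.symm (t'.symm ((f' h)⁻¹ • t' y)) = t.symm (h⁻¹ • y)
    rw [← map_inv, ← ht', Equiv.symm_apply_apply]

/-- The identity triple is by definition the one induced by the identity group isomorphism and the
identity bijection. -/
theorem id_comp (S : Span A B) : ((id B).comp S).IsIso S :=
  ofEquiv_comp (MulEquiv.refl B.Grp) (Equiv.refl B.Pts) (fun _ _ => rfl) (Equiv.refl _)
    (fun _ _ _ => rfl) (fun _ => rfl) (fun _ => rfl)

theorem comp_id (S : Span A B) : (S.comp (id A)).IsIso S :=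
  comp_ofEquiv (MulEquiv.refl A.Grp) (Equiv.refl A.Pts) (fun _ _ => rfl) (Equiv.refl _)
    (fun _ _ _ => rfl) (fun _ => rfl) (fun _ => rfl)

/-- Inversion of arrows in the action groupoid: `(g, x)`, the arrow `g⁻¹ x ⟶ x`, goes to its inverse
`(g⁻¹, g⁻¹ x)`. -/
theorem op_id (A : GFrac.{u} R) : (id A).op.IsIso (id A) := by
  refine isIso_of_bijective (S := (id A).op) (T := id A)
    (fun p : A.Grp × A.Pts => (p.1⁻¹, p.1⁻¹ • p.2)) ?_ ?_ ?_ ?_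
  · refine Function.Involutive.bijective fun p : A.Grp × A.Pts => ?_
    simp
    rfl
  · rintro ⟨a, b⟩ ⟨g, x⟩
    refine Prod.ext (show (b * g * a⁻¹)⁻¹ = a * g⁻¹ * b⁻¹ by simp [mul_assoc]) ?_
    change (b * g * a⁻¹)⁻¹ • b • x = a • g⁻¹ • x
    simp [smul_smul, mul_assoc]
  · intro p
    rfl
  · rintro ⟨g, x⟩
    change g⁻¹⁻¹ • g⁻¹ • x = x
    simp

/-! ### The product of triples -/

theorem tens_congr {S T : Span A B} {S' T' : Span A' B'} (h : S.IsIso T) (h' : S'.IsIso T') :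
    (S.tens S').IsIso (T.tens T') := by
  obtain ⟨e, e₁, e₂, e₃⟩ := h
  obtain ⟨d, d₁, d₂, d₃⟩ := h'
  exact ⟨Equiv.prodCongr e d, fun k u => Prod.ext (e₁ _ _) (d₁ _ _),
    fun u => Prod.ext (e₂ _) (d₂ _), fun u => Prod.ext (e₃ _) (d₃ _)⟩

theorem disjUnion_tens (S T : Span A B) (W : Span A' B') :
    ((S.disjUnion T).tens W).IsIso ((S.tens W).disjUnion (T.tens W)) := by
  refine ⟨Equiv.sumProdDistrib S.U T.U W.U, ?_, ?_, ?_⟩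
  · rintro k ⟨u | u, w⟩ <;> rfl
  · rintro ⟨u | u, w⟩ <;> rfl
  · rintro ⟨u | u, w⟩ <;> rfl

theorem tens_disjUnion (W : Span A' B') (S T : Span A B) :
    (W.tens (S.disjUnion T)).IsIso ((W.tens S).disjUnion (W.tens T)) := by
  refine ⟨Equiv.prodSumDistrib W.U S.U T.U, ?_, ?_, ?_⟩
  · rintro k ⟨w, u | u⟩ <;> rfl
  · rintro ⟨w, u | u⟩ <;> rfl
  · rintro ⟨w, u | u⟩ <;> rfl

theorem ofEquiv_tens_ofEquiv (f : A.Grp ≃* B.Grp) (t : A.Pts ≃ B.Pts)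
    (ht : ∀ (g : A.Grp) (x : A.Pts), t (g • x) = f g • t x)
    (f' : A'.Grp ≃* B'.Grp) (t' : A'.Pts ≃ B'.Pts)
    (ht' : ∀ (g : A'.Grp) (x : A'.Pts), t' (g • x) = f' g • t' x) :
    ((ofEquiv f t ht).tens (ofEquiv f' t' ht')).IsIso
      (ofEquiv (A := tensObj A A') (B := tensObj B B') (MulEquiv.prodCongr f f')
        (Equiv.prodCongr t t') (fun g x => Prod.ext (ht g.1 x.1) (ht' g.2 x.2))) :=
  ⟨Equiv.prodProdProdComm B.Grp B.Pts B'.Grp B'.Pts, fun _ _ => rfl, fun _ => rfl, fun _ => rfl⟩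

theorem id_tens_id (A A' : GFrac.{u} R) : ((id A).tens (id A')).IsIso (id (tensObj A A')) :=
  ofEquiv_tens_ofEquiv (MulEquiv.refl A.Grp) (Equiv.refl A.Pts) (fun _ _ => rfl)
    (MulEquiv.refl A'.Grp) (Equiv.refl A'.Pts) (fun _ _ => rfl)

/-- The orbits of a product group acting on a product of pullbacks are the pairs of orbits. -/
theorem comp_tens_comp (V : Span B C) (U : Span A B) (V' : Span B' C') (U' : Span A' B') :
    ((V.comp U).tens (V'.comp U')).IsIso ((V.tens V').comp (U.tens U')) := by
  refine isIso_of_surjective (P := Pullback V U × Pullback V' U')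
    (fun x => (glue V U x.1.1.1 x.1.1.2 x.1.2, glue V' U' x.2.1.1 x.2.1.2 x.2.2))
    (fun x => glue (V.tens V') (U.tens U') (x.1.1.1, x.2.1.1) (x.1.1.2, x.2.1.2)
      (Prod.ext x.1.2 x.2.2)) ?_ ?_ ?_ ?_ ?_ ?_
  · rintro ⟨w, w'⟩
    obtain ⟨v, u, h, rfl⟩ := glue_surjective _ _ w
    obtain ⟨v', u', h', rfl⟩ := glue_surjective _ _ w'
    exact ⟨(⟨(v, u), h⟩, ⟨(v', u'), h'⟩), rfl⟩
  · intro w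
    obtain ⟨⟨v, v'⟩, ⟨u, u'⟩, h, rfl⟩ := glue_surjective _ _ w
    exact ⟨(⟨(v, u), congrArg Prod.fst h⟩, ⟨(v', u'), congrArg Prod.snd h⟩), rfl⟩
  · intro x y
    refine Prod.ext_iff.trans (Iff.trans (and_congr glue_eq_iff glue_eq_iff)
      (Iff.trans ?_ glue_eq_iff.symm))
    constructor
    · rintro ⟨⟨b, h₁, h₂⟩, b', h₁', h₂'⟩
      exact ⟨(b, b'), Prod.ext h₁ h₁', Prod.ext h₂ h₂'⟩
    · rintro ⟨⟨b, b'⟩, h, h'⟩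
      exact ⟨⟨b, congrArg Prod.fst h, congrArg Prod.fst h'⟩,
        b', congrArg Prod.snd h, congrArg Prod.snd h'⟩
  · rintro ⟨⟨c, c'⟩, ⟨a, a'⟩⟩ ⟨⟨⟨v, u⟩, h⟩, ⟨⟨v', u'⟩, h'⟩⟩
    exact ⟨(⟨((c, (1 : B.Grp)) • v, ((1 : B.Grp), a) • u), α_smul_eq_β_smul h c a⟩,
      ⟨((c', (1 : B'.Grp)) • v', ((1 : B'.Grp), a') • u'), α_smul_eq_β_smul h' c' a'⟩), rfl, rfl⟩
  · intro x
    rfl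
  · intro x
    rfl

/-! ### Invariant subsets -/

/-- The restriction of a triple to an invariant subset. -/
def sub (S : Span A B) (P : Set S.U) (hP : ∀ (k : B.Grp × A.Grp), ∀ u ∈ P, k • u ∈ P) :
    Span A B where
  U := P
  action :=
    { smul := fun k u => ⟨k • u.1, hP k u u.2⟩
      one_smul := fun u => Subtype.ext (one_smul _ u.1)
      mul_smul := fun k l u => Subtype.ext (mul_smul k l u.1) }
  β := fun u => S.β u
  α := fun u => S.α u
  β_smul := fun k u => S.β_smul k u
  α_smul := fun k u => S.α_smul k u

theorem disjUnion_sub_sub (S : Span A B) {P Q : Set S.U} (hP) (hQ) (h : IsCompl P Q) :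
    ((S.sub P hP).disjUnion (S.sub Q hQ)).IsIso S := by
  refine isIso_of_bijective (S := (S.sub P hP).disjUnion (S.sub Q hQ))
    (Sum.elim (fun u : P => u.1) (fun u : Q => u.1)) ⟨?_, ?_⟩ ?_ ?_ ?_
  · refine Function.Injective.sumElim Subtype.val_injective Subtype.val_injective ?_
    rintro ⟨u, hu⟩ ⟨v, hv⟩ (rfl : u = v)
    exact Set.disjoint_left.1 h.disjoint hu hv
  · intro u
    rcases (h.sup_eq_top.ge (Set.mem_univ u) : u ∈ P ∪ Q) with hu | hu
    · exact ⟨Sum.inl ⟨u, hu⟩, rfl⟩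
    · exact ⟨Sum.inr ⟨u, hu⟩, rfl⟩
  · rintro k (u | u) <;> rfl
  · rintro (u | u) <;> rfl
  · rintro (u | u) <;> rfl

/-! ### Triples induced by equivariant maps -/

/-- The triple from `X/G` to `Y/H` given by a homomorphism of groups `f : G → H` and a map
`t : X → Y` with `t (g x) = f g (t x)`: it is `(H × X, (h, x) ↦ h (t x), (h, x) ↦ x)` with the
action `(h₁, g) (h, x) = (h₁ h (f g)⁻¹, g x)`. -/
def ofHom (f : A.Grp →* B.Grp) (t : A.Pts → B.Pts)
    (ht : ∀ (g : A.Grp) (x : A.Pts), t (g • x) = f g • t x) : Span A B where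
  U := B.Grp × A.Pts
  action :=
    { smul := fun k p => (k.1 * p.1 * (f k.2)⁻¹, k.2 • p.2)
      one_smul := fun p => Prod.ext
        (show 1 * p.1 * (f 1)⁻¹ = p.1 by simp) (one_smul _ p.2)
      mul_smul := fun k l p => Prod.ext
        (show k.1 * l.1 * p.1 * (f (k.2 * l.2))⁻¹
            = k.1 * (l.1 * p.1 * (f l.2)⁻¹) * (f k.2)⁻¹ by
          simp [mul_assoc]) (mul_smul k.2 l.2 p.2) }
  β := fun p => p.1 • t p.2
  α := fun p => p.2
  β_smul := fun k p =>
    show (k.1 * p.1 * (f k.2)⁻¹) • t (k.2 • p.2) = k.1 • p.1 • t p.2 by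
      simp [ht, smul_smul]
  α_smul := fun _ _ => rfl

section ofHom

variable (f : A.Grp →* B.Grp) (t : A.Pts → B.Pts)
  (ht : ∀ (g : A.Grp) (x : A.Pts), t (g • x) = f g • t x)

/-- With `full`, injectivity of `f` makes `(f, t)` a fully faithful functor of action groupoids; the
composite is the biset of arrows `t x' ⟶ t x`, which are the arrows `x' ⟶ x`. -/
theorem op_ofHom_comp_ofHom (hf : Function.Injective f)
    (full : ∀ (h : B.Grp) x x', h • t x = t x' → ∃ g, f g = h ∧ g • x = x') :
    ((ofHom f t ht).op.comp (ofHom f t ht)).IsIso (id A) := by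
  refine isIso_of_surjective (S := (ofHom f t ht).op.comp (ofHom f t ht)) (T := id A)
    (P := A.Grp × A.Pts)
    -- Balancing makes the first group coordinate `1`; fullness then shows that the second is some
    -- `f g`.
    (fun p => glue (ofHom f t ht).op (ofHom f t ht) (1, p.2) (f p.1, p.1⁻¹ • p.2)
      (show (1 : B.Grp) • t p.2 = f p.1 • t (p.1⁻¹ • p.2) by simp [ht])) (fun p => p)
    ?_ Function.surjective_id ?_ ?_ ?_ ?_
  · intro w
    obtain ⟨⟨h, x⟩, ⟨h', x'⟩, e, rfl⟩ := glue_surjective _ _ w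
    have e₁ : h • t x = h' • t x' := e
    obtain ⟨g, hg, rfl⟩ := full (h⁻¹ * h') x' x (by rw [mul_smul, ← e₁, inv_smul_smul])
    refine ⟨(g, g • x'), glue_eq_iff.2 ⟨h, Prod.ext ?_ ?_, Prod.ext ?_ ?_⟩⟩
    · change h = h * 1 * (f 1)⁻¹
      simp
    · exact (one_smul A.Grp _).symm
    · change h' = h * f g * (f 1)⁻¹
      simp [hg]
    · change x' = (1 : A.Grp) • g⁻¹ • g • x'
      simp
  · rintro ⟨g, x⟩ ⟨g', x'⟩
    refine ⟨fun e => ?_, fun e => by rw [e]⟩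
    obtain ⟨h, h₁, h₂⟩ := glue_eq_iff.1 e
    have h₃ : (1 : B.Grp) = h * 1 * (f 1)⁻¹ := congrArg Prod.fst h₁
    have h₄ : x' = (1 : A.Grp) • x := congrArg Prod.snd h₁
    have h₅ : f g' = h * f g * (f 1)⁻¹ := congrArg Prod.fst h₂
    obtain rfl : 1 = h := by simpa using h₃
    rw [one_smul] at h₄
    refine Prod.ext (hf ?_) h₄.symm
    simpa using h₅.symm
  · rintro ⟨a, b⟩ ⟨g, x⟩
    refine ⟨(a * g * b⁻¹, a • x), ?_, rfl⟩
    refine (glue_eq_smul_iff _ _).2 ⟨f a, Prod.ext ?_ rfl, Prod.ext ?_ ?_⟩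
    · change (1 : B.Grp) = f a * 1 * (f a)⁻¹
      simp
    · change f (a * g * b⁻¹) = f a * f g * (f b)⁻¹
      simp
    · change (a * g * b⁻¹)⁻¹ • a • x = b • g⁻¹ • x
      simp [smul_smul, mul_assoc]
  · rintro ⟨g, x⟩
    rfl
  · rintro ⟨g, x⟩
    rfl

theorem smul_mem_orbits {k : B.Grp × B.Grp} (p : (id B).U) (hp : ∃ (h : B.Grp) (x : A.Pts), p.2 = h • t x) :
    ∃ (h : B.Grp) (x : A.Pts), (k • p).2 = h • t x := by
  obtain ⟨h, x, e⟩ := hp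
  exact ⟨k.1 * h, x, by rw [mul_smul, ← e]; rfl⟩

/-- The composite consists of the arrows of `B` between points of the essential image of `t`. It is
the idempotent that cuts out one summand of a biproduct. -/
theorem ofHom_comp_op_ofHom (full : ∀ (h : B.Grp) x x', h • t x = t x' → ∃ g, f g = h ∧ g • x = x') :
    ((ofHom f t ht).comp (ofHom f t ht).op).IsIso
      ((id B).sub {p | ∃ (h : B.Grp) (x : A.Pts), p.2 = h • t x} (fun _ p hp => smul_mem_orbits t p hp)) := by
  refine comp_isIso_of (V := ofHom f t ht) (U := (ofHom f t ht).op)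
    (T := (id B).sub {p | ∃ (h : B.Grp) (x : A.Pts), p.2 = h • t x} (fun _ p hp => smul_mem_orbits t p hp))
    -- Balancing by `a` multiplies both group coordinates on the right by `(f a)⁻¹`, so `h h'⁻¹` is
    -- invariant; it is an arrow `h' • t x ⟶ h • t x`.
    (fun v u => ⟨(v.1 * u.1⁻¹, v.1 • t v.2), v.1, v.2, rfl⟩) ?_ ?_ ?_ ?_ ?_ ?_
  · rintro ⟨⟨k, y⟩, h, x, e⟩
    obtain rfl : y = h • t x := e
    refine ⟨(h, x), (k⁻¹ * h, x), rfl, Subtype.ext (Prod.ext ?_ rfl)⟩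
    change h * (k⁻¹ * h)⁻¹ = k
    simp
  · rintro a ⟨h, x⟩ ⟨h', x'⟩ (e : x = x')
    refine Subtype.ext (Prod.ext ?_ ?_)
    · change 1 * h * (f a)⁻¹ * (1 * h' * (f a)⁻¹)⁻¹ = h * h'⁻¹
      simp
    · change (1 * h * (f a)⁻¹) • t (a • x) = h • t x
      simp [ht, smul_smul]
  · rintro ⟨h, x⟩ ⟨h', x'⟩ ⟨l, y⟩ ⟨l', y'⟩ (e : x = x') (e' : y = y') e''
    have e₁ : h * h'⁻¹ = l * l'⁻¹ := congrArg (fun p => p.1.1) e''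
    have e₂ : h • t x = l • t y := congrArg (fun p => p.1.2) e''
    obtain ⟨g, hg, rfl⟩ := full (l⁻¹ * h) x y (by rw [mul_smul, e₂, inv_smul_smul])
    subst e e'
    refine ⟨g, Prod.ext ?_ rfl, Prod.ext ?_ rfl⟩
    · change l = 1 * h * (f g)⁻¹
      simp [hg]
    · change l' = 1 * h' * (f g)⁻¹
      rw [hg, ← inv_inj, ← mul_right_inj l, ← e₁]
      simp [mul_assoc]
  · rintro c a ⟨h, x⟩ ⟨h', x'⟩ e
    refine Subtype.ext (Prod.ext ?_ ?_)
    · change c * h * (f 1)⁻¹ * (a * h' * (f 1)⁻¹)⁻¹ = c * (h * h'⁻¹) * a⁻¹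
      simp [mul_assoc]
    · change (c * h * (f 1)⁻¹) • t ((1 : A.Grp) • x) = c • h • t x
      simp [smul_smul]
  · rintro v u e
    rfl
  · rintro ⟨h, x⟩ ⟨h', x'⟩ (e : x = x')
    subst e
    change (h * h'⁻¹)⁻¹ • h • t x = h' • t x
    simp [smul_smul]

theorem isEmpty_op_ofHom_comp_ofHom (f' : A'.Grp →* B.Grp) (t' : A'.Pts → B.Pts)
    (ht' : ∀ (g : A'.Grp) (x : A'.Pts), t' (g • x) = f' g • t' x)
    (hd : ∀ (h : B.Grp) x x', h • t x ≠ t' x') :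
    IsEmpty ((ofHom f' t' ht').op.comp (ofHom f t ht)).U := by
  refine ⟨fun w => ?_⟩
  obtain ⟨⟨h, x⟩, ⟨h', x'⟩, e, -⟩ := glue_surjective _ _ w
  have e₁ : h • t' x = h' • t x' := e
  refine hd (h⁻¹ * h') x' x ?_
  rw [mul_smul, ← e₁, inv_smul_smul]

end ofHom

end Span

/-! ### Classes of triples -/

namespace Span

theorem IsIso.cls_eq {S T : Span A B} (h : S.IsIso T) : S.cls = T.cls := by
  refine congrArg (fun x : Burnside A B => (1 : R) ⊗ₜ[ℤ] x) ?_
  rw [← sub_eq_zero]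
  exact (QuotientAddGroup.eq_zero_iff _).2 (AddSubgroup.subset_closure (BurnsideRel.iso S T h))

theorem cls_disjUnion (S T : Span A B) : (S.disjUnion T).cls = S.cls + T.cls := by
  refine Eq.trans (congrArg (fun x : Burnside A B => (1 : R) ⊗ₜ[ℤ] x) ?_)
    (TensorProduct.tmul_add _ _ _)
  rw [← sub_eq_zero]
  exact (QuotientAddGroup.eq_zero_iff _).2 (AddSubgroup.subset_closure (BurnsideRel.add S T))

/-- An empty triple is isomorphic to its own double, so its class equals twice itself. -/
theorem cls_eq_zero (S : Span A B) [IsEmpty S.U] : S.cls = 0 := by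
  have h : (S.disjUnion S).IsIso S := by
    refine ⟨(Equiv.equivOfIsEmpty (S.U ⊕ S.U) S.U), ?_, ?_, ?_⟩ <;>
    · intros
      rename_i u
      exact (IsEmpty.false (α := S.U ⊕ S.U) u).elim
  simpa [cls_disjUnion] using h.cls_eq

end Span

/-! ### Universal property of the morphism modules -/

namespace Mor

section lift

variable {M : Type*} [AddCommGroup M] [Module R M] (F : Span A B → M)
  (iso : ∀ S T : Span A B, S.IsIso T → F S = F T)
  (add : ∀ S T : Span A B, F (S.disjUnion T) = F S + F T)

/-- An additive invariant of triples extends to a linear map on the morphisms. -/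
noncomputable def lift : Mor R A B →ₗ[R] M :=
  LinearMap.liftBaseChange R (AddMonoidHom.toIntLinearMap
    (QuotientAddGroup.lift _ (FreeAbelianGroup.lift F) (by
      rw [AddSubgroup.closure_le]
      rintro _ (⟨S, T, h⟩ | ⟨S, T⟩)
      · simp [iso S T h]
      · simp [add S T])))

@[simp]
theorem lift_cls (S : Span A B) : lift F iso add S.cls = F S := by
  refine (LinearMap.liftBaseChange_one_tmul _ _ _).trans ?_
  exact FreeAbelianGroup.lift_apply_of _ _

end lift

-- The classes of triples span the morphisms over `R`, so linear statements need checking on triples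
-- only.
@[elab_as_elim]
theorem induction {p : Mor R A B → Prop} (f : Mor R A B) (cls : ∀ S : Span A B, p S.cls)
    (zero : p 0) (add : ∀ f g, p f → p g → p (f + g)) (smul : ∀ (r : R) f, p f → p (r • f)) :
    p f := by
  induction f using TensorProduct.induction_on with
  | zero => exact zero
  | add f g hf hg => exact add f g hf hg
  | tmul r x =>
    have h : p ((1 : R) ⊗ₜ x) := by
      obtain ⟨x, rfl⟩ := QuotientAddGroup.mk_surjective x
      induction x using FreeAbelianGroup.induction_on with
      | zero => simpa using zero
      | of S => exact cls S
      | neg S h =>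
        -- Negatives of generators come from the scalar `-1`.
        have := smul (-1) _ (cls S)
        rw [neg_one_smul] at this
        simpa [Span.cls, TensorProduct.tmul_neg] using this
      | add x y hx hy =>
        have := add _ _ hx hy
        rwa [← TensorProduct.tmul_add] at this
    simpa [TensorProduct.smul_tmul'] using smul r _ h

theorem hom_ext {M : Type*} [AddCommMonoid M] [Module R M] {φ ψ : Mor R A B →ₗ[R] M}
    (h : ∀ S : Span A B, φ S.cls = ψ S.cls) : φ = ψ := by
  ext1 f
  refine induction (p := fun f => φ f = ψ f) f h ?_ ?_ ?_
  · simp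
  · intro f g hf hg
    rw [map_add, map_add, hf, hg]
  · intro r f hf
    rw [map_smul, map_smul, hf]

theorem hom_ext₂ {M : Type*} [AddCommMonoid M] [Module R M]
    {φ ψ : Mor R A B →ₗ[R] Mor R A' B' →ₗ[R] M}
    (h : ∀ (S : Span A B) (S' : Span A' B'), φ S.cls S'.cls = ψ S.cls S'.cls) : φ = ψ :=
  hom_ext fun S => hom_ext (h S)

/-- A biadditive invariant of pairs of triples extends to a bilinear map on the morphisms. -/
noncomputable def lift₂ {M : Type*} [AddCommGroup M] [Module R M] (F : Span A B → Span A' B' → M)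
    (iso : ∀ S T S' T', S.IsIso T → S'.IsIso T' → F S S' = F T T')
    (add_left : ∀ S T S', F (S.disjUnion T) S' = F S S' + F T S')
    (add_right : ∀ S S' T', F S (S'.disjUnion T') = F S S' + F S T') :
    Mor R A B →ₗ[R] Mor R A' B' →ₗ[R] M :=
  lift (fun S => lift (F S) (fun S' T' h => iso S S S' T' (Span.IsIso.refl S) h) (add_right S))
    (fun S T h => hom_ext fun S' => by simpa using iso S T S' S' h (Span.IsIso.refl S'))
    (fun S T => hom_ext fun S' => by simpa using add_left S T S')

@[simp]
theorem lift₂_cls_cls {M : Type*} [AddCommGroup M] [Module R M] (F : Span A B → Span A' B' → M)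
    (iso add_left add_right) (S : Span A B) (S' : Span A' B') :
    lift₂ F iso add_left add_right S.cls S'.cls = F S S' := by
  simp [lift₂]

/-! ### Composition, tensor product and duality of morphisms -/

/-- The bilinear composition of morphisms. -/
noncomputable def comp : Composition.{u} R := fun _ _ _ =>
  lift₂ (fun V U => (V.comp U).cls) (fun _ _ _ _ h h' => (Span.comp_congr h' h).cls_eq)
    (fun V V' U => (Span.disjUnion_comp V V' U).cls_eq.trans (Span.cls_disjUnion _ _))
    (fun V U U' => (Span.comp_disjUnion V U U').cls_eq.trans (Span.cls_disjUnion _ _))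

@[simp]
theorem comp_cls (V : Span B C) (U : Span A B) : comp A B C V.cls U.cls = (V.comp U).cls :=
  lift₂_cls_cls _ _ _ _ _ _

theorem id_comp (A B : GFrac.{u} R) (f : Mor R A B) : comp A B B (Span.id B).cls f = f := by
  induction f using Mor.induction with
  | cls S => simpa using (Span.id_comp S).cls_eq
  | _ => simp_all

theorem comp_id (A B : GFrac.{u} R) (f : Mor R A B) : comp A A B f (Span.id A).cls = f := by
  induction f using Mor.induction with
  | cls S => simpa using (Span.comp_id S).cls_eq
  | _ => simp_all

theorem assoc (A B C D : GFrac.{u} R) (f : Mor R A B) (g : Mor R B C) (h : Mor R C D) :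
    comp A B D (comp B C D h g) f = comp A C D h (comp A B C g f) := by
  induction h using Mor.induction with
  | cls W =>
    induction g using Mor.induction with
    | cls V =>
      induction f using Mor.induction with
      | cls U => simpa using (Span.comp_assoc W V U).cls_eq
      | _ => simp_all
    | _ => simp_all
  | _ => simp_all

/-- The bilinear tensor product of morphisms. -/
noncomputable def tens (A B A' B' : GFrac.{u} R) :
    Mor R A B →ₗ[R] Mor R A' B' →ₗ[R] Mor R (tensObj A A') (tensObj B B') :=
  lift₂ (fun U U' => (U.tens U').cls)
    (fun _ _ _ _ h h' => (Span.tens_congr h h').cls_eq)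
    (fun V V' U => (Span.disjUnion_tens V V' U).cls_eq.trans (Span.cls_disjUnion _ _))
    (fun V U U' => (Span.tens_disjUnion V U U').cls_eq.trans (Span.cls_disjUnion _ _))

@[simp]
theorem tens_cls (U : Span A B) (U' : Span A' B') :
    tens A B A' B' U.cls U'.cls = (U.tens U').cls :=
  lift₂_cls_cls _ _ _ _ _ _

theorem id_tens_id (A A' : GFrac.{u} R) :
    tens A A A' A' (Span.id A).cls (Span.id A').cls = (Span.id (tensObj A A')).cls :=
  (tens_cls _ _).trans (Span.id_tens_id A A').cls_eq

theorem comp_tens_comp (g : Mor R B C) (f : Mor R A B) (g' : Mor R B' C') (f' : Mor R A' B') :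
    tens A C A' C' (comp A B C g f) (comp A' B' C' g' f') =
      comp _ _ _ (tens B C B' C' g g') (tens A B A' B' f f') := by
  induction g using Mor.induction with
  | cls V =>
    induction g' using Mor.induction with
    | cls V' =>
      induction f using Mor.induction with
      | cls U =>
        induction f' using Mor.induction with
        | cls U' => simpa using (Span.comp_tens_comp V U V' U').cls_eq
        | _ => simp_all
      | _ => simp_all
    | _ => simp_all
  | _ => simp_all

/-- The linear duality on morphisms. -/
noncomputable def op (A B : GFrac.{u} R) : Mor R A B →ₗ[R] Mor R B A :=
  lift (fun U => U.op.cls) (fun _ _ h => (Span.op_congr h).cls_eq)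
    (fun S T => (Span.op_disjUnion S T).cls_eq.trans (Span.cls_disjUnion _ _))

@[simp]
theorem op_cls (U : Span A B) : op A B U.cls = U.op.cls :=
  lift_cls _ _ _ _

theorem op_op (f : Mor R A B) : op B A (op A B f) = f := by
  induction f using Mor.induction with
  | cls S => simp [Span.op_op]
  | _ => simp_all

theorem op_id (A : GFrac.{u} R) : op A A (Span.id A).cls = (Span.id A).cls :=
  (op_cls _).trans (Span.op_id A).cls_eq

theorem op_comp (g : Mor R B C) (f : Mor R A B) :
    op A C (comp A B C g f) = comp C B A (op A B f) (op B C g) := by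
  induction g using Mor.induction with
  | cls V =>
    induction f using Mor.induction with
    | cls U => simpa using (Span.op_comp V U).cls_eq.symm
    | _ => simp_all
  | _ => simp_all

end Mor

/-! ### The category of fractions -/

noncomputable instance instCategory : Category.{max v (u + 1)} (GFrac.{u} R) :=
  category Mor.comp Mor.id_comp Mor.comp_id Mor.assoc

noncomputable instance instPreadditive : Preadditive (GFrac.{u} R) :=
  preadditive Mor.comp Mor.id_comp Mor.comp_id Mor.assoc

/-- The class of a triple as a morphism of the category of fractions. -/
noncomputable abbrev Span.hom (S : Span A B) : A ⟶ B :=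
  S.cls

namespace Span

theorem hom_comp_hom (U : Span A B) (V : Span B C) : U.hom ≫ V.hom = (V.comp U).hom :=
  Mor.comp_cls V U

theorem IsIso.hom_eq {S T : Span A B} (h : S.IsIso T) : S.hom = T.hom :=
  h.cls_eq

theorem hom_disjUnion (S T : Span A B) : (S.disjUnion T).hom = S.hom + T.hom :=
  cls_disjUnion S T

theorem hom_id (A : GFrac.{u} R) : (id A).hom = 𝟙 A :=
  rfl

theorem hom_eq_zero (S : Span A B) [IsEmpty S.U] : S.hom = 0 :=
  cls_eq_zero S

end Span

/-! ### Biproducts -/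

theorem isZero_zeroObj : IsZero (zeroObj : GFrac.{u} R) := by
  rw [IsZero.iff_id_eq_zero, ← Span.hom_id]
  have : IsEmpty (Span.id (zeroObj : GFrac.{u} R)).U :=
    inferInstanceAs (IsEmpty (PUnit × PEmpty))
  exact Span.hom_eq_zero _

namespace Span

/-- The points of the first summand. -/
def inlPts (A B : GFrac.{u} R) (x : A.Pts) : (sumObj A B).Pts :=
  Sum.inl (x, 1)

/-- The points of the second summand. -/
def inrPts (A B : GFrac.{u} R) (y : B.Pts) : (sumObj A B).Pts :=
  Sum.inr (1, y)

/-- The inclusion of the first summand. -/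
def inl (A B : GFrac.{u} R) : Span A (sumObj A B) :=
  ofHom (B := sumObj A B) (MonoidHom.inl A.Grp B.Grp) (inlPts A B)
    (fun _ _ => congrArg Sum.inl (Prod.ext rfl (mul_one 1).symm))

/-- The inclusion of the second summand. -/
def inr (A B : GFrac.{u} R) : Span B (sumObj A B) :=
  ofHom (B := sumObj A B) (MonoidHom.inr A.Grp B.Grp) (inrPts A B)
    (fun _ _ => congrArg Sum.inr (Prod.ext (mul_one 1).symm rfl))

/-- The added factor `H` carries the free translation action, so an element of `G × H` that sends
`(x, 1)` to `(x', 1)` has trivial `H`-component. -/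
theorem inl_full (A B : GFrac.{u} R) (k : (sumObj A B).Grp) (x x' : A.Pts)
    (e : k • inlPts A B x = inlPts A B x') :
    ∃ g, MonoidHom.inl A.Grp B.Grp g = k ∧ g • x = x' := by
  obtain ⟨g, h⟩ := k
  have e' : (g • x, h * 1) = (x', (1 : B.Grp)) := Sum.inl_injective e
  rw [Prod.mk.injEq, mul_one] at e'
  exact ⟨g, Prod.ext rfl e'.2.symm, e'.1⟩

theorem inr_full (A B : GFrac.{u} R) (k : (sumObj A B).Grp) (y y' : B.Pts)
    (e : k • inrPts A B y = inrPts A B y') :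
    ∃ h, MonoidHom.inr A.Grp B.Grp h = k ∧ h • y = y' := by
  obtain ⟨g, h⟩ := k
  have e' : (g * 1, h • y) = ((1 : A.Grp), y') := Sum.inr_injective e
  rw [Prod.mk.injEq, mul_one] at e'
  exact ⟨h, Prod.ext e'.1.symm rfl, e'.2⟩

theorem op_inl_comp_inl (A B : GFrac.{u} R) : ((inl A B).op.comp (inl A B)).IsIso (id A) :=
  op_ofHom_comp_ofHom (B := sumObj A B) _ _ _ (fun _ _ h => congrArg Prod.fst h) (inl_full A B)

theorem op_inr_comp_inr (A B : GFrac.{u} R) : ((inr A B).op.comp (inr A B)).IsIso (id B) :=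
  op_ofHom_comp_ofHom (B := sumObj A B) _ _ _ (fun _ _ h => congrArg Prod.snd h) (inr_full A B)

theorem isEmpty_op_inr_comp_inl (A B : GFrac.{u} R) : IsEmpty ((inr A B).op.comp (inl A B)).U :=
  isEmpty_op_ofHom_comp_ofHom (B := sumObj A B) _ _ _ _ _ _ fun _ _ _ => Sum.inl_ne_inr

theorem isEmpty_op_inl_comp_inr (A B : GFrac.{u} R) : IsEmpty ((inl A B).op.comp (inr A B)).U :=
  isEmpty_op_ofHom_comp_ofHom (B := sumObj A B) _ _ _ _ _ _ fun _ _ _ => Sum.inr_ne_inl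

/-- Each point of the sum is a translate of a point from exactly one summand, so the two idempotents
are complementary parts of the identity triple. -/
theorem disjUnion_inl_inr (A B : GFrac.{u} R) :
    (((inl A B).comp (inl A B).op).disjUnion ((inr A B).comp (inr A B).op)).IsIso
      (id (sumObj A B)) := by
  refine (disjUnion_congr (ofHom_comp_op_ofHom (B := sumObj A B) _ _ _ (inl_full A B))
    (ofHom_comp_op_ofHom (B := sumObj A B) _ _ _ (inr_full A B))).trans
    (disjUnion_sub_sub _ _ _ ?_)
  refine ⟨Set.disjoint_left.2 ?_, codisjoint_iff.2 (Set.eq_univ_of_forall ?_)⟩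
  · rintro p ⟨k, x, e⟩ ⟨l, y, e'⟩
    exact Sum.inl_ne_inr (e.symm.trans e')
  · rintro ⟨k, ⟨x, h⟩ | ⟨g, y⟩⟩
    -- Translation by `(1, h)` carries the base point `(x, 1)` to `(x, h)`.
    · exact Or.inl ⟨(1, h), x, congrArg Sum.inl (Prod.ext (one_smul _ _).symm (mul_one h).symm)⟩
    · exact Or.inr ⟨(g, 1), y, congrArg Sum.inr (Prod.ext (mul_one g).symm (one_smul _ _).symm)⟩

end Span

/-- The biproduct of two fractions. -/
noncomputable def sumBicone (A B : GFrac.{u} R) : BinaryBicone A B where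
  pt := sumObj A B
  fst := (Span.inl A B).op.hom
  snd := (Span.inr A B).op.hom
  inl := (Span.inl A B).hom
  inr := (Span.inr A B).hom
  inl_fst := by rw [Span.hom_comp_hom, (Span.op_inl_comp_inl A B).hom_eq, Span.hom_id]
  inl_snd := by
    have := Span.isEmpty_op_inr_comp_inl A B
    rw [Span.hom_comp_hom, Span.hom_eq_zero]
  inr_fst := by
    have := Span.isEmpty_op_inl_comp_inr A B
    rw [Span.hom_comp_hom, Span.hom_eq_zero]
  inr_snd := by rw [Span.hom_comp_hom, (Span.op_inr_comp_inr A B).hom_eq, Span.hom_id]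

theorem sumBicone_total (A B : GFrac.{u} R) :
    (sumBicone A B).fst ≫ (sumBicone A B).inl + (sumBicone A B).snd ≫ (sumBicone A B).inr =
      𝟙 (sumBicone A B).pt := by
  change (Span.inl A B).op.hom ≫ (Span.inl A B).hom +
    (Span.inr A B).op.hom ≫ (Span.inr A B).hom = 𝟙 (sumObj A B)
  rw [Span.hom_comp_hom, Span.hom_comp_hom, ← Span.hom_disjUnion,
    (Span.disjUnion_inl_inr A B).hom_eq, Span.hom_id]

theorem hasFiniteBiproducts : HasFiniteBiproducts (GFrac.{u} R) := by
  have : HasTerminal (GFrac.{u} R) := isZero_zeroObj.isTerminal.hasTerminal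
  have : HasBinaryBiproducts (GFrac.{u} R) :=
    ⟨fun A B => HasBinaryBiproduct.mk ⟨_, isBinaryBilimitOfTotal _ (sumBicone_total A B)⟩⟩
  have : HasFiniteProducts (GFrac.{u} R) := hasFiniteProducts_of_has_binary_and_terminal
  exact HasFiniteBiproducts.of_hasFiniteProducts

/-! ### The symmetric monoidal structure -/

/-- The tensor product of morphisms of fractions. -/
noncomputable abbrev tensHom (f : A ⟶ B) (f' : A' ⟶ B') : tensObj A A' ⟶ tensObj B B' :=
  Mor.tens A B A' B' f f'

/-- An isomorphism of groups together with an equivariant bijection of sets. -/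
@[ext]
structure Isom (A B : GFrac.{u} R) where
  /-- the isomorphism of groups -/
  grp : A.Grp ≃* B.Grp
  /-- the bijection of sets -/
  pts : A.Pts ≃ B.Pts
  map_smul : ∀ (g : A.Grp) (x : A.Pts), pts (g • x) = grp g • pts x

namespace Isom

/-- The identity. -/
def refl (A : GFrac.{u} R) : Isom A A :=
  ⟨MulEquiv.refl A.Grp, Equiv.refl A.Pts, fun _ _ => rfl⟩

/-- The inverse. -/
def symm (e : Isom A B) : Isom B A :=
  ⟨e.grp.symm, e.pts.symm, fun h y => by
    rw [Equiv.symm_apply_eq, e.map_smul, MulEquiv.apply_symm_apply, Equiv.apply_symm_apply]⟩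

/-- The composite. -/
def trans (e : Isom A B) (e' : Isom B C) : Isom A C :=
  ⟨e.grp.trans e'.grp, e.pts.trans e'.pts, fun g x => by simp [e.map_smul, e'.map_smul]⟩

/-- The product. -/
def tens (e : Isom A B) (e' : Isom A' B') : Isom (tensObj A A') (tensObj B B') :=
  ⟨MulEquiv.prodCongr e.grp e'.grp, Equiv.prodCongr e.pts e'.pts,
    fun g x => Prod.ext (e.map_smul g.1 x.1) (e'.map_smul g.2 x.2)⟩

/-- The canonical isomorphism `(A ⊗ B) ⊗ C ≅ A ⊗ (B ⊗ C)`. -/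
def assoc (A B C : GFrac.{u} R) : Isom (tensObj (tensObj A B) C) (tensObj A (tensObj B C)) :=
  ⟨(MulEquiv.prodAssoc : (A.Grp × B.Grp) × C.Grp ≃* A.Grp × B.Grp × C.Grp),
    Equiv.prodAssoc A.Pts B.Pts C.Pts, fun _ _ => rfl⟩

/-- The canonical isomorphism `1 ⊗ A ≅ A`. -/
def leftUnit (A : GFrac.{u} R) : Isom (tensObj unitObj A) A :=
  ⟨(MulEquiv.uniqueProd : PUnit.{u + 1} × A.Grp ≃* A.Grp), Equiv.punitProd A.Pts, fun _ _ => rfl⟩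

/-- The canonical isomorphism `A ⊗ 1 ≅ A`. -/
def rightUnit (A : GFrac.{u} R) : Isom (tensObj A unitObj) A :=
  ⟨(MulEquiv.prodUnique : A.Grp × PUnit.{u + 1} ≃* A.Grp), Equiv.prodPUnit A.Pts, fun _ _ => rfl⟩

/-- The canonical isomorphism `A ⊗ B ≅ B ⊗ A`. -/
def swap (A B : GFrac.{u} R) : Isom (tensObj A B) (tensObj B A) :=
  ⟨(MulEquiv.prodComm : A.Grp × B.Grp ≃* B.Grp × A.Grp), Equiv.prodComm A.Pts B.Pts,
    fun _ _ => rfl⟩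

theorem trans_symm (e : Isom A B) : e.trans e.symm = refl A := by
  ext x
  · exact e.grp.symm_apply_apply x
  · exact e.pts.symm_apply_apply x

theorem symm_trans (e : Isom A B) : e.symm.trans e = refl B := by
  ext x
  · exact e.grp.apply_symm_apply x
  · exact e.pts.apply_symm_apply x

/-- The morphism of fractions induced by an isomorphism of groups and a bijection of sets. -/
noncomputable def hom (e : Isom A B) : A ⟶ B :=
  (Span.ofEquiv e.grp e.pts e.map_smul).hom

theorem hom_refl (A : GFrac.{u} R) : (refl A).hom = 𝟙 A :=
  rfl

theorem hom_trans (e : Isom A B) (e' : Isom B C) : e.hom ≫ e'.hom = (e.trans e').hom :=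
  (Span.hom_comp_hom _ _).trans (Span.ofEquiv_comp_ofEquiv _ _ _ _ _ _).hom_eq

theorem hom_tens (e : Isom A B) (e' : Isom A' B') :
    tensHom e.hom e'.hom = (e.tens e').hom :=
  (Mor.tens_cls _ _).trans (Span.ofEquiv_tens_ofEquiv _ _ _ _ _ _).cls_eq

/-- The isomorphism of fractions induced by an isomorphism of groups and a bijection of sets. -/
noncomputable abbrev toIso (e : Isom A B) : A ≅ B where
  hom := e.hom
  inv := e.symm.hom
  hom_inv_id := by rw [hom_trans, trans_symm, hom_refl]
  inv_hom_id := by rw [hom_trans, symm_trans, hom_refl]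

end Isom

/-- The interchange law applied to `f ≫ 𝟙` and `𝟙 ≫ f'`. -/
theorem tensHom_def (f : A ⟶ B) (f' : A' ⟶ B') :
    tensHom f f' = tensHom f (𝟙 A') ≫ tensHom (𝟙 B) f' := by
  refine Eq.trans ?_ (Mor.comp_tens_comp (𝟙 B) f f' (𝟙 A'))
  exact congrArg₂ (fun x y => Mor.tens A B A' B' x y) (Mor.id_comp A B f).symm
    (Mor.comp_id A' B' f').symm

/-- By trilinearity it is enough to treat triples, where reassociating the underlying sets is
equivariant over the associators. -/
theorem associator_naturality (f : A ⟶ B) (f' : A' ⟶ B') (f'' : A'' ⟶ B'') :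
    tensHom (tensHom f f') f'' ≫ (Isom.assoc B B' B'').hom =
      (Isom.assoc A A' A'').hom ≫ tensHom f (tensHom f' f'') := by
  change Mor.comp _ _ _ (Span.assoc B B' B'').cls
      (Mor.tens _ _ _ _ (Mor.tens _ _ _ _ f f') f'') =
    Mor.comp _ _ _ (Mor.tens _ _ _ _ f (Mor.tens _ _ _ _ f' f'')) (Span.assoc A A' A'').cls
  induction f using Mor.induction with
  | cls S =>
    induction f' using Mor.induction with
    | cls S' =>
      induction f'' using Mor.induction with
      | cls S'' =>
        simp only [Mor.tens_cls, Mor.comp_cls]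
        exact (Span.ofEquiv_naturality _ _ _ _ _ _ (Equiv.prodAssoc S.U S'.U S''.U)
          (fun _ _ _ => rfl) (fun _ => rfl) (fun _ => rfl)).cls_eq
      | _ => simp_all
    | _ => simp_all
  | _ => simp_all

theorem leftUnitor_naturality (f : A ⟶ B) :
    tensHom (𝟙 unitObj) f ≫ (Isom.leftUnit B).hom = (Isom.leftUnit A).hom ≫ f := by
  change Mor.comp _ _ _ (Span.leftUnit B).cls (Mor.tens _ _ _ _ (Span.id unitObj).cls f) =
    Mor.comp _ _ _ f (Span.leftUnit A).cls
  induction f using Mor.induction with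
  | cls S =>
    simp only [Mor.tens_cls, Mor.comp_cls]
    exact (Span.ofEquiv_naturality _ _ _ _ _ _
      (((Equiv.punitProd PUnit.{u + 1}).prodCongr (Equiv.refl S.U)).trans (Equiv.punitProd S.U))
      (fun _ _ _ => rfl) (fun _ => rfl) (fun _ => rfl)).cls_eq
  | _ => simp_all

theorem rightUnitor_naturality (f : A ⟶ B) :
    tensHom f (𝟙 unitObj) ≫ (Isom.rightUnit B).hom = (Isom.rightUnit A).hom ≫ f := by
  change Mor.comp _ _ _ (Span.rightUnit B).cls (Mor.tens _ _ _ _ f (Span.id unitObj).cls) =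
    Mor.comp _ _ _ f (Span.rightUnit A).cls
  induction f using Mor.induction with
  | cls S =>
    simp only [Mor.tens_cls, Mor.comp_cls]
    exact (Span.ofEquiv_naturality _ _ _ _ _ _
      (((Equiv.refl S.U).prodCongr (Equiv.punitProd PUnit.{u + 1})).trans (Equiv.prodPUnit S.U))
      (fun _ _ _ => rfl) (fun _ => rfl) (fun _ => rfl)).cls_eq
  | _ => simp_all

/-- All morphisms involved are induced by some `Isom`, compatibly with composition and tensor
product, and the two resulting `Isom`s coincide by definition. The triangle, hexagon and symmetry
axioms hold for the same reason. -/
theorem pentagon (A B C D : GFrac.{u} R) :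
    tensHom (Isom.assoc A B C).hom (𝟙 D) ≫ (Isom.assoc A (tensObj B C) D).hom ≫
      tensHom (𝟙 A) (Isom.assoc B C D).hom =
    (Isom.assoc (tensObj A B) C D).hom ≫ (Isom.assoc A B (tensObj C D)).hom := by
  simp only [← Isom.hom_refl, Isom.hom_tens, Isom.hom_trans]
  rfl

theorem triangle (A B : GFrac.{u} R) :
    (Isom.assoc A unitObj B).hom ≫ tensHom (𝟙 A) (Isom.leftUnit B).hom =
      tensHom (Isom.rightUnit A).hom (𝟙 B) := by
  simp only [← Isom.hom_refl, Isom.hom_tens, Isom.hom_trans]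
  rfl

theorem braiding_naturality (f : A ⟶ B) (f' : A' ⟶ B') :
    tensHom f f' ≫ (Isom.swap B B').hom = (Isom.swap A A').hom ≫ tensHom f' f := by
  change Mor.comp _ _ _ (Span.swap B B').cls (Mor.tens _ _ _ _ f f') =
    Mor.comp _ _ _ (Mor.tens _ _ _ _ f' f) (Span.swap A A').cls
  induction f using Mor.induction with
  | cls S =>
    induction f' using Mor.induction with
    | cls S' =>
      simp only [Mor.tens_cls, Mor.comp_cls]
      exact (Span.ofEquiv_naturality _ _ _ _ _ _ (Equiv.prodComm S.U S'.U)
          (fun _ _ _ => rfl) (fun _ => rfl) (fun _ => rfl)).cls_eq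
    | _ => simp_all
  | _ => simp_all

theorem hexagon_forward (A B C : GFrac.{u} R) :
    (Isom.assoc A B C).hom ≫ (Isom.swap A (tensObj B C)).hom ≫ (Isom.assoc B C A).hom =
      tensHom (Isom.swap A B).hom (𝟙 C) ≫ (Isom.assoc B A C).hom ≫
        tensHom (𝟙 B) (Isom.swap A C).hom := by
  simp only [← Isom.hom_refl, Isom.hom_tens, Isom.hom_trans]
  rfl

theorem hexagon_reverse (A B C : GFrac.{u} R) :
    (Isom.assoc A B C).symm.hom ≫ (Isom.swap (tensObj A B) C).hom ≫ (Isom.assoc C A B).symm.hom =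
      tensHom (𝟙 A) (Isom.swap B C).hom ≫ (Isom.assoc A C B).symm.hom ≫
        tensHom (Isom.swap A C).hom (𝟙 B) := by
  simp only [← Isom.hom_refl, Isom.hom_tens, Isom.hom_trans]
  rfl

theorem symmetry (A B : GFrac.{u} R) :
    (Isom.swap A B).hom ≫ (Isom.swap B A).hom = 𝟙 (tensObj A B) := by
  simp only [← Isom.hom_refl, Isom.hom_trans]
  rfl

theorem isMonoidal : IsMonoidal (monoidalStruct (R := R)
    (fun {A B A' B'} f f' => Mor.tens A B A' B' f f') (fun A B C => (Isom.assoc A B C).toIso)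
    (fun A => (Isom.leftUnit A).toIso) (fun A => (Isom.rightUnit A).toIso)) :=
  ⟨{ toMonoidalCategoryStruct := monoidalStruct (R := R)
        (fun {A B A' B'} f f' => Mor.tens A B A' B' f f') (fun A B C => (Isom.assoc A B C).toIso)
        (fun A => (Isom.leftUnit A).toIso) (fun A => (Isom.rightUnit A).toIso)
     tensorHom_def := fun f g => (tensHom_def f g)
     id_tensorHom_id := Mor.id_tens_id
     tensorHom_comp_tensorHom := fun f₁ f₂ g₁ g₂ => (Mor.comp_tens_comp g₁ f₁ g₂ f₂).symm
     whiskerLeft_id := Mor.id_tens_id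
     id_whiskerRight := Mor.id_tens_id
     associator_naturality := associator_naturality
     leftUnitor_naturality := leftUnitor_naturality
     rightUnitor_naturality := rightUnitor_naturality
     pentagon := pentagon
     triangle := triangle }, rfl⟩

noncomputable instance instMonoidalCategory : MonoidalCategory (GFrac.{u} R) :=
  monoidal _ isMonoidal

noncomputable instance instSymmetricCategory : SymmetricCategory (GFrac.{u} R) where
  braiding A B := (Isom.swap A B).toIso
  braiding_naturality_right A _ _ f := braiding_naturality (𝟙 A) f
  braiding_naturality_left f A := braiding_naturality f (𝟙 A)
  hexagon_forward := hexagon_forward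
  hexagon_reverse := hexagon_reverse
  symmetry := symmetry

/-! ### Duality -/

/-- `Mor.op` is an involution, hence bijective on morphisms, and the functor is the identity on
objects. -/
theorem isEquivalence_dualFunctor :
    (dualFunctor (R := R) (fun {A B} f => Mor.op A B f) Mor.op_id
      (fun f g => Mor.op_comp g f)).IsEquivalence where
  faithful := ⟨fun {A B f g} h => by
    have h' : Mor.op A B f = Mor.op A B g := congrArg Quiver.Hom.unop h
    rw [← Mor.op_op f, h', Mor.op_op]⟩
  full := ⟨fun {A B} f => ⟨Mor.op B A f.unop, Quiver.Hom.unop_inj (Mor.op_op f.unop)⟩⟩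
  essSurj := ⟨fun A => ⟨A.unop, ⟨Iso.refl _⟩⟩⟩

end GFrac

theorem mainTheorem3 (R : Type v) [CommRing R] :
    -- isomorphic triples have isomorphic composites
    (∀ (A B C : GFrac.{u} R) (U U' : GFrac.Span A B) (V V' : GFrac.Span B C),
      U.IsIso U' → V.IsIso V' → (V.comp U).IsIso (V'.comp U')) ∧
    -- composition of triples extends uniquely to a bilinear composition of morphisms
    ∃ c : GFrac.Composition.{u} R,
      (∀ (A B C : GFrac.{u} R) (V : GFrac.Span B C) (U : GFrac.Span A B),
        c A B C V.cls U.cls = (V.comp U).cls) ∧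
      (∀ c' : GFrac.Composition.{u} R,
        (∀ (A B C : GFrac.{u} R) (V : GFrac.Span B C) (U : GFrac.Span A B),
          c' A B C V.cls U.cls = (V.comp U).cls) → c' = c) ∧
      -- the laws of a category
      ∃ (id_comp : ∀ (A B : GFrac.{u} R) (f : GFrac.Mor R A B),
            c A B B (GFrac.Span.id B).cls f = f)
        (comp_id : ∀ (A B : GFrac.{u} R) (f : GFrac.Mor R A B),
            c A A B f (GFrac.Span.id A).cls = f)
        (assoc : ∀ (A B C D : GFrac.{u} R)
            (f : GFrac.Mor R A B) (g : GFrac.Mor R B C) (h : GFrac.Mor R C D),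
            c A B D (c B C D h g) f = c A C D h (c A B C g f)),
        letI : Category.{max v (u + 1)} (GFrac.{u} R) := GFrac.category c id_comp comp_id assoc
        letI : Preadditive (GFrac.{u} R) := GFrac.preadditive c id_comp comp_id assoc
        -- additive
        (IsZero (GFrac.zeroObj : GFrac.{u} R) ∧ HasFiniteBiproducts (GFrac.{u} R) ∧
          ∀ A B : GFrac.{u} R,
            ∃ b : BinaryBicone A B, b.pt = GFrac.sumObj A B ∧ Nonempty b.IsBilimit) ∧
        -- symmetric monoidal
        (∃ (T : ∀ A B A' B' : GFrac.{u} R, GFrac.Mor R A B →ₗ[R] GFrac.Mor R A' B' →ₗ[R]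
              GFrac.Mor R (GFrac.tensObj A A') (GFrac.tensObj B B'))
            (a : ∀ A B C : GFrac.{u} R, GFrac.tensObj (GFrac.tensObj A B) C ≅
              GFrac.tensObj A (GFrac.tensObj B C))
            (l : ∀ A : GFrac.{u} R, GFrac.tensObj GFrac.unitObj A ≅ A)
            (r : ∀ A : GFrac.{u} R, GFrac.tensObj A GFrac.unitObj ≅ A),
          (∀ (A B A' B' : GFrac.{u} R) (U : GFrac.Span A B) (U' : GFrac.Span A' B'),
            T A B A' B' U.cls U'.cls = (U.tens U').cls) ∧
          (∀ A B C : GFrac.{u} R, (a A B C).hom = (GFrac.Span.assoc A B C).cls) ∧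
          (∀ A : GFrac.{u} R, (l A).hom = (GFrac.Span.leftUnit A).cls) ∧
          (∀ A : GFrac.{u} R, (r A).hom = (GFrac.Span.rightUnit A).cls) ∧
          ∃ hM : GFrac.IsMonoidal
              (GFrac.monoidalStruct (fun {A B A' B'} f f' => T A B A' B' f f') a l r),
            letI : MonoidalCategory (GFrac.{u} R) := GFrac.monoidal _ hM
            ∃ s : SymmetricCategory (GFrac.{u} R),
              ∀ A B : GFrac.{u} R, (s.braiding A B).hom = (GFrac.Span.swap A B).cls) ∧
        -- self-dual
        (∃ D : ∀ A B : GFrac.{u} R, GFrac.Mor R A B →ₗ[R] GFrac.Mor R B A,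
          (∀ (A B : GFrac.{u} R) (U : GFrac.Span A B), D A B U.cls = U.op.cls) ∧
          ∃ (D_id : ∀ A : GFrac.{u} R, D A A (𝟙 A) = 𝟙 A)
            (D_comp : ∀ {A B C : GFrac.{u} R} (f : A ⟶ B) (g : B ⟶ C),
              D A C (f ≫ g) = CategoryStruct.comp (obj := GFrac.{u} R) (D B C g) (D A B f)),
            (GFrac.dualFunctor (fun {A B} f => D A B f) D_id D_comp).IsEquivalence) := by
  refine ⟨fun A B C U U' V V' => GFrac.Span.comp_congr, GFrac.Mor.comp,
    fun A B C => GFrac.Mor.comp_cls, fun c' hc' => ?_, GFrac.Mor.id_comp, GFrac.Mor.comp_id,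
    GFrac.Mor.assoc, ⟨GFrac.isZero_zeroObj, GFrac.hasFiniteBiproducts, fun A B =>
      ⟨GFrac.sumBicone A B, rfl, ⟨isBinaryBilimitOfTotal _ (GFrac.sumBicone_total A B)⟩⟩⟩,
    ⟨GFrac.Mor.tens, fun A B C => (GFrac.Isom.assoc A B C).toIso,
      fun A => (GFrac.Isom.leftUnit A).toIso, fun A => (GFrac.Isom.rightUnit A).toIso,
      fun A B A' B' => GFrac.Mor.tens_cls, fun A B C => rfl, fun A => rfl, fun A => rfl,
      GFrac.isMonoidal, GFrac.instSymmetricCategory, fun A B => rfl⟩,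
    ⟨GFrac.Mor.op, fun A B => GFrac.Mor.op_cls, GFrac.Mor.op_id,
      fun f g => GFrac.Mor.op_comp g f, GFrac.isEquivalence_dualFunctor⟩⟩
  -- Uniqueness: a bilinear map is determined by its values on pairs of classes.
  funext A B C
  exact GFrac.Mor.hom_ext₂ fun V U => (hc' A B C V U).trans (GFrac.Mor.comp_cls V U).symm
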